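/- **Setting.** Let $r\ge 1$, $n_1\ge n_2\ge\dots\ge n_r\ge 1$, $n=n_1+\dots+n_r$, $s_0=0$, $s_i=n_1+\dots+n_i$. Let $A_0=\mathrm{diag}(A_{01},\dots,A_{0r})$, where $A_{0i}$ is the $n_i\times n_i$ matrix with ones on the first superdiagonal and zeros elsewhere; let $B_0$ be the $n\times r$ matrix with $(B_0)_{s_i i}=1$ and all other elements zero; let $K$ be an $n\times n$ real matrix whose rows other than the rows $s_1,\dots,s_r$ are zero (the rows $s_i$ are $(k_{s_i j})_{j=1}^n$). Put $$F^{-1}=\int_0^1(1-t)e^{-A_0t}B_0B_0^*e^{-A_0^*t}\,dt,\qquad D(\Theta)=\mathrm{diag}(D_1(\Theta),\dots,D_r(\Theta)),\quad D_i(\Theta)=\mathrm{diag}\bigl(\Theta^{-\frac{2n_i-2j+1}{2}}\bigr)_{j=1}^{n_i},$$ $$H=\mathrm{diag}(H_1,\dots,H_r),\quad H_i=\mathrm{diag}\bigl(-\tfrac{2n_i-2j+1}{2}\bigr)_{j=1}^{n_i},\qquad F^1=F-FH-HF,\qquad \widetilde G=|(F^1)^{-1}|\,(F\widetilde R+\widetilde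 R^*F),$$ where $|M|$ is the entrywise absolute value and $\widetilde R$ is the block diagonal matrix whose $i$-th block is the $n_i\times n_i$ matrix with ones on the first superdiagonal and zeros elsewhere. Let $\rho(M)$ be the spectral radius and $\|M\|$ the norm of a matrix induced by the Euclidean norms. Consider the system with perturbed superdiagonal elements $$\dot x_{s_{i-1}+j}=\bigl(1+r_{(s_{i-1}+j)(s_{i-1}+j+1)}(t,x)\bigr)x_{s_{i-1}+j+1}\ (1\le j\le n_i-1),\qquad \dot x_{s_i}=\sum_{j=1}^n k_{s_ij}x_j+u_i,\qquad i=1,\dots,r,\tag{1}$$ that is, $\dot x=(A_0+K+R(t,x))x+B_0u$, where the only elements of $R(t,x)$ that may be nonzero are those on the first superdiagonals of the diagonal blocks. For a set $Q\subset\mathbb R^n$ and $\Delta\ge 0$ the perturbation $R$ is called *admissible on $Q$* if its elements are continuous functions on $[0,\infty)\times Q$, its superdiagonal elements are bounded by $\Delta$ in absolute value there, and for every $\rho_2$ there is $\ell_1(\rho_2)$ such that $\|R(t,x'')x''-R(t,x')x'\|\le \ell_1(\rho_2)\|x''-x'\|$ for all $t\ge0$ and all $x',x''\in Q$ of norm at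 most $\rho_2$. **Theorem.** Let $0<\gamma<1$, $\Delta=\dfrac{1-\gamma}{\rho(\widetilde G)}$ (if $n_1=1$ then $\rho(\widetilde G)=0$, there are no perturbations and the value of $\Delta$ is immaterial), $c>0$, and $$0<a_0\le\frac{2}{\|F^{-1}\|\cdot\bigl(\|B_0^*F\|+2\max\{c^{n_1},c\}\|B_0^*K\|\bigr)^2}.$$ Then the matrices $F^{-1}$ (hence $F$) and $F^1$ are positive definite; for every $x\ne0$ the equation $2a_0\Theta=(D(\Theta)FD(\Theta)x,x)$ has a unique positive solution $\Theta=\Theta(x)$ (put $\Theta(0)=0$); and the set $Q=\{x:\Theta(x)\le c\}$ is the ellipsoid $\{x:(D(c)FD(c)x,x)\le 2a_0c\}$, a neighbourhood of the origin. Moreover, the control $$u(x)=-\Bigl(\tfrac12B_0^*D(\Theta(x))FD(\Theta(x))+B_0^*K\Bigr)x$$ (with $u(0)=0$) satisfies $\|u(x)\|\le1$ for all $x\in Q$ and solves the local robust feedback synthesis for (1) in $Q$ with the following bound on the time of motion: for every perturbation $R$ admissible on $Q$ and every $x_0\in Q$ there is a finite time $T=T(x_0,R)\ge0$ with $$T\le\frac{\Theta(x_0)}{\gamma}$$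 such that the closed-loop system $\dot x=(A_0+K+R(t,x))x+B_0u(x)$ has a trajectory in $Q$ with $x(0)=x_0$, defined, continuous on $[0,T]$, satisfying the equation and nonzero on $[0,T)$, and ending at the origin, $\lim_{t\to T}x(t)=x(T)=0$; and this trajectory is unique: every trajectory in $Q$ starting at $x_0$ coincides with it up to time $T$ for as long as it is defined. If $K\equiv0$, the synthesis is global: the same assertions (the bound $\|u(x)\|\le1$, and the existence and uniqueness of the trajectory with its arrival at the origin at some $T\le\Theta(x_0)/\gamma$) hold with $Q$ replaced by $\mathbb R^n$, that is, for all $x,x_0\in\mathbb R^n$ and all perturbations admissible on $\mathbb R^n$. -/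

import Mathlib

open Set Filter Topology Matrix

noncomputable section

namespace Korobov

/-- Coordinates of the state: `⟨i, j⟩` is the coordinate number `j + 1` of the block number `i + 1`,
so that `x ⟨i, j⟩` is `x_{n_1 + ⋯ + n_{i} + j + 1}` in the usual linear numbering. -/
abbrev Idx {r : ℕ} (n : Fin r → ℕ) : Type := Σ i : Fin r, Fin (n i)

/-- The state space `ℝⁿ`, `n = n_1 + ⋯ + n_r`, with the Euclidean norm. -/
abbrev State {r : ℕ} (n : Fin r → ℕ) : Type := EuclideanSpace ℝ (Idx n)

/-- The control space `ℝʳ` with the Euclidean norm. -/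
abbrev Control (r : ℕ) : Type := EuclideanSpace ℝ (Fin r)

/-- The (spectral) norm of a real matrix, induced by the Euclidean norms. -/
def opNorm {ι κ : Type} [Fintype ι] [Fintype κ] [DecidableEq κ] (M : Matrix ι κ ℝ) : ℝ :=
  ‖LinearMap.toContinuousLinearMap (Matrix.toEuclideanLin M)‖

/-- The spectral radius of a real square matrix: the largest modulus of its complex eigenvalues. -/
def specRad {ι : Type} [Fintype ι] [DecidableEq ι] (M : Matrix ι ι ℝ) : ℝ :=
  (spectralRadius ℂ (M.map (fun a : ℝ => (a : ℂ)))).toReal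

/-- The quadratic form `(M x, x)`. -/
def quadForm {ι : Type} [Fintype ι] (M : Matrix ι ι ℝ) (x : EuclideanSpace ℝ ι) : ℝ :=
  (M *ᵥ x.ofLp) ⬝ᵥ x.ofLp

/-- The matrix `M` acting on Euclidean vectors. -/
def act {ι κ : Type} [Fintype κ] (M : Matrix ι κ ℝ) (x : EuclideanSpace ℝ κ) :
    EuclideanSpace ℝ ι :=
  WithLp.toLp 2 (M *ᵥ x.ofLp)

variable {r : ℕ} (n : Fin r → ℕ)

/-- `(p, q)` is a position on the main superdiagonal of one of the diagonal blocks. -/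
def IsSuperdiag (p q : Idx n) : Prop := p.1 = q.1 ∧ (p.2 : ℕ) + 1 = (q.2 : ℕ)

instance (p q : Idx n) : Decidable (IsSuperdiag n p q) :=
  inferInstanceAs (Decidable (_ ∧ _))

/-- `A₀ = diag(A₀₁, …, A₀ᵣ)`, where `A₀ᵢ` has ones on the superdiagonal and zeros elsewhere. -/
def A0 : Matrix (Idx n) (Idx n) ℝ := Matrix.of fun p q => if IsSuperdiag n p q then 1 else 0

/-- `B₀`: its column `i` has a one in the last row of the block `i` and zeros elsewhere. -/
def B0 : Matrix (Idx n) (Fin r) ℝ :=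
  Matrix.of fun p i => if p.1 = i ∧ (p.2 : ℕ) + 1 = n p.1 then 1 else 0

/-- `K`: the last row of the block `i` is the row `(k i j)_j`, all the other rows are zero. -/
def K (k : Matrix (Fin r) (Idx n) ℝ) : Matrix (Idx n) (Idx n) ℝ :=
  Matrix.of fun p q => if (p.2 : ℕ) + 1 = n p.1 then k p.1 q else 0

/-- `F⁻¹ = ∫₀¹ (1 - t) e^{-A₀ t} B₀ B₀* e^{-A₀* t} dt`. -/
def Finv : Matrix (Idx n) (Idx n) ℝ :=
  Matrix.of fun p q => ∫ t in (0 : ℝ)..1,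
    (1 - t) * (NormedSpace.exp (-(t • A0 n)) * B0 n * (B0 n)ᵀ
      * NormedSpace.exp (-(t • (A0 n)ᵀ))) p q

/-- The matrix `F`. -/
def F : Matrix (Idx n) (Idx n) ℝ := (Finv n)⁻¹

/-- The number `(2 nᵢ - 2 j + 1) / 2`, where `j` is the one-based position in the block `i`. -/
def expo (p : Idx n) : ℝ := (2 * (n p.1 : ℝ) - 2 * ((p.2 : ℕ) + 1 : ℝ) + 1) / 2

/-- `D(Θ) = diag(Θ^{-(2 nᵢ - 2 j + 1) / 2})`. -/
def D (θ : ℝ) : Matrix (Idx n) (Idx n) ℝ := Matrix.diagonal fun p => θ ^ (-expo n p)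

/-- `H = diag(-(2 nᵢ - 2 j + 1) / 2)`. -/
def H : Matrix (Idx n) (Idx n) ℝ := Matrix.diagonal fun p => -expo n p

/-- `F¹ = F - F H - H F`. -/
def F1 : Matrix (Idx n) (Idx n) ℝ := F n - F n * H n - H n * F n

/-- `R̃`: the superdiagonal perturbation matrix all of whose free entries are equal to one. -/
def Rtilde : Matrix (Idx n) (Idx n) ℝ :=
  Matrix.of fun p q => if IsSuperdiag n p q then 1 else 0

/-- `G̃ = |(F¹)⁻¹| (F R̃ + R̃* F)`, with the entrywise absolute value. -/
def Gtilde : Matrix (Idx n) (Idx n) ℝ :=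
  ((F1 n)⁻¹).map (fun a : ℝ => |a|) * (F n * Rtilde n + (Rtilde n)ᵀ * F n)

/-- `θ` is a positive solution of `2 a₀ θ = (D(θ) F D(θ) x, x)`. -/
def IsRoot (a₀ : ℝ) (x : State n) (θ : ℝ) : Prop :=
  0 < θ ∧ 2 * a₀ * θ = quadForm (D n θ * F n * D n θ) x

open Classical in
/-- The controllability function: `Θ(0) = 0`, and for `x ≠ 0` the value `Θ(x)` is the positive
solution of `2 a₀ Θ = (D(Θ) F D(Θ) x, x)`. -/
def Theta (a₀ : ℝ) (x : State n) : ℝ :=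
  if h : x ≠ 0 ∧ ∃ θ, IsRoot n a₀ x θ then h.2.choose else 0

/-- The control `u(x) = -(½ B₀* D(Θ(x)) F D(Θ(x)) + B₀* K) x`. -/
def control (k : Matrix (Fin r) (Idx n) ℝ) (a₀ : ℝ) (x : State n) : Control r :=
  -act ((1 / 2 : ℝ) • ((B0 n)ᵀ * D n (Theta n a₀ x) * F n * D n (Theta n a₀ x))
      + (B0 n)ᵀ * K n k) x

/-- The perturbations of the superdiagonal elements that are admissible on `[0, ∞) × Q` with the
bound `Δ`. Only the values at `t ≥ 0` and `x ∈ Q` matter. -/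
structure Admissible (Q : Set (State n)) (Δ : ℝ)
    (R : ℝ → State n → Matrix (Idx n) (Idx n) ℝ) : Prop where
  superdiag : ∀ t, 0 ≤ t → ∀ x ∈ Q, ∀ p q, ¬ IsSuperdiag n p q → R t x p q = 0
  continuous : ∀ p q, ContinuousOn (fun z : ℝ × State n => R z.1 z.2 p q) (Ici 0 ×ˢ Q)
  bound : ∀ t, 0 ≤ t → ∀ x ∈ Q, ∀ p q, IsSuperdiag n p q → |R t x p q| ≤ Δ
  lipschitz : ∀ ρ : ℝ, ∃ L : ℝ, ∀ t, 0 ≤ t → ∀ x' ∈ Q, ∀ x'' ∈ Q, ‖x'‖ ≤ ρ → ‖x''‖ ≤ ρ →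
    ‖act (R t x'') x'' - act (R t x') x'‖ ≤ L * ‖x'' - x'‖

/-- The right-hand side `(A₀ + K + R(t, x)) x + B₀ u(x)` of the closed-loop system. -/
def closedLoop (k : Matrix (Fin r) (Idx n) ℝ) (R : ℝ → State n → Matrix (Idx n) (Idx n) ℝ)
    (u : State n → Control r) (t : ℝ) (x : State n) : State n :=
  act (A0 n + K n k + R t x) x + act (B0 n) (u x)

/-- `x` is a trajectory of `ẋ = f(t, x)` in `Q` on the time interval `[0, T]` with `x(0) = x₀`:
it is continuous on `[0, T]` and satisfies the equation on `[0, T)` (one-sidedly at `0`). -/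
structure IsTrajectory (f : ℝ → State n → State n) (Q : Set (State n)) (x₀ : State n) (T : ℝ)
    (x : ℝ → State n) : Prop where
  init : x 0 = x₀
  mem : ∀ t ∈ Icc 0 T, x t ∈ Q
  cont : ContinuousOn x (Icc 0 T)
  ode : ∀ t ∈ Ico 0 T, HasDerivWithinAt x (f t (x t)) (Icc 0 T) t

/-- The control `u` solves the robust feedback synthesis on `Q` for the system with perturbed
superdiagonal elements, the range of the perturbations being given by `Δ`, and the time of motion
from `x₀` is at most `τ x₀`: `Q` is a neighbourhood of the origin, `‖u‖ ≤ 1` on `Q`, and for every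
admissible perturbation and every `x₀ ∈ Q` the trajectory of the closed-loop system that starts at
`x₀` exists, is unique, stays in `Q`, and arrives at the origin at a finite time `T ≤ τ x₀`. -/
structure SolvesRobustSynthesis (k : Matrix (Fin r) (Idx n) ℝ) (Q : Set (State n)) (Δ : ℝ)
    (u : State n → Control r) (τ : State n → ℝ) : Prop where
  nhds : Q ∈ 𝓝 (0 : State n)
  bounded : ∀ x ∈ Q, ‖u x‖ ≤ 1
  steers : ∀ R, Admissible n Q Δ R → ∀ x₀ ∈ Q, ∃ T : ℝ, 0 ≤ T ∧ T ≤ τ x₀ ∧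
    ∃ x : ℝ → State n, IsTrajectory n (closedLoop n k R u) Q x₀ T x ∧
      (∀ t ∈ Ico 0 T, x t ≠ 0) ∧ x T = 0 ∧
      ∀ (T' : ℝ) (y : ℝ → State n), IsTrajectory n (closedLoop n k R u) Q x₀ T' y →
        ∀ t ∈ Icc 0 T', t ≤ T → y t = x t

end Korobov

end

namespace Korobov

variable {r : ℕ} (n : Fin r → ℕ)

/-! The controllability function Θ is a Lyapunov function that decreases at rate at least γ, so Θ
must reach 0 by time Θ(x₀)/γ.

Put y = D(Θ(x))x, so that 2a₀Θ = (Fy, y). Conjugation by D(Θ) multiplies every superdiagonal matrix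
by Θ⁻¹, and the `K` part of the control cancels `K`. Hence D(Θ)ẋ = Θ⁻¹(A₀ + R - ½B₀B₀*F)y. Implicit
differentiation of the root equation gives Θ̇·(F¹y, y) = 2Θ(Fy, D(Θ)ẋ). By the Riccati equation
`riccati_F` the right-hand side is -(F¹y, y) + ((FR + R*F)y, y) (`fderiv_Theta_loopField_le`). Here
F¹ = F(∫₀¹ e^{-A₀t}B₀B₀*e^{-A₀*t}dt)F is positive definite, because (A₀, B₀) is controllable.

It remains to bound the perturbation term by (1 - γ)(F¹y, y) (`perturbation_quadratic_le`). Its best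
constant is a generalized eigenvalue of FR + R*F with respect to F¹. Taking absolute values in the
eigenvector equation and using the Collatz–Wielandt bound `le_specRad` compares it with Δρ(G̃). This
requires |FR + R*F| ≤ Δ(FR̃ + R̃*F) entrywise, which holds because F has nonnegative entries
(`F_nonneg`): polynomials orthogonal with weight 1 - t on [0, 1] factor F as CᵀdC with C and d
nonnegative.

The closed-loop field is C¹ only off the origin. It is therefore modified near 0 and precomposed
with the projection onto the compact convex ellipsoid {Θ ≤ Θ(x₀)}. The solution is followed until Θ
drops to a level ε (`exists_trajectory_until`), and the pieces for ε → 0 are glued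
(`exists_trajectory_to_origin`). Uniqueness comes from the local Lipschitz property off the origin.
-/

/-- The distance of a coordinate from the last coordinate of its block. -/
def codist (p : Idx n) : ℕ := n p.1 - 1 - p.2

variable {n}

/-! ### Block coordinates counted from the end of the block -/

lemma codist_add (p : Idx n) : codist n p + p.2 + 1 = n p.1 := by
  have := p.2.2
  unfold codist
  omega

lemma idx_ext {p q : Idx n} (h : p.1 = q.1) (h' : codist n p = codist n q) : p = q := by
  obtain ⟨i, a⟩ := p
  obtain ⟨j, b⟩ := q
  obtain rfl : i = j := h
  have h1 := codist_add ⟨i, a⟩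
  have h2 := codist_add ⟨i, b⟩
  simp only at h1 h2
  congr 1
  exact Fin.ext (by omega)

lemma isSuperdiag_iff {p q : Idx n} :
    IsSuperdiag n p q ↔ p.1 = q.1 ∧ codist n p = codist n q + 1 := by
  unfold IsSuperdiag
  refine and_congr_right fun h => ?_
  have h1 := codist_add p
  have h2 := codist_add q
  have h3 : n p.1 = n q.1 := by rw [h]
  omega

lemma last_iff {p : Idx n} : (p.2 : ℕ) + 1 = n p.1 ↔ codist n p = 0 := by
  have h1 := codist_add p
  omega

lemma exists_idx (i : Fin r) {m : ℕ} (hm : m < n i) : ∃ p : Idx n, p.1 = i ∧ codist n p = m :=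
  ⟨⟨i, ⟨n i - 1 - m, by omega⟩⟩, rfl, by simp only [codist]; omega⟩

lemma codist_lt (p : Idx n) : codist n p < n p.1 := by
  have := codist_add p
  omega

lemma expo_eq (p : Idx n) : expo n p = codist n p + 1 / 2 := by
  have h : ((codist n p + p.2 + 1 : ℕ) : ℝ) = n p.1 := by rw [codist_add]
  push_cast at h
  unfold expo
  linarith

/-! ### The shift `A0` and the matrix e^{-A₀t}B₀ -/

lemma A0_apply (p q : Idx n) : A0 n p q = if IsSuperdiag n p q then 1 else 0 := rfl

lemma A0_mul_apply_of_codist_eq_zero {κ : Type} (X : Matrix (Idx n) κ ℝ) {p : Idx n}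
    (hp : codist n p = 0) (j : κ) : (A0 n * X) p j = 0 := by
  rw [Matrix.mul_apply]
  refine Finset.sum_eq_zero fun q _ => ?_
  rw [A0_apply, if_neg, zero_mul]
  rw [isSuperdiag_iff]
  omega

lemma A0_mul_apply_of_isSuperdiag {κ : Type} (X : Matrix (Idx n) κ ℝ) {p q : Idx n}
    (h : IsSuperdiag n p q) (j : κ) : (A0 n * X) p j = X q j := by
  rw [Matrix.mul_apply, Finset.sum_eq_single q]
  · rw [A0_apply, if_pos h, one_mul]
  · intro q' _ hq'
    rw [A0_apply, if_neg, zero_mul]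
    intro h'
    rw [isSuperdiag_iff] at h h'
    exact hq' (idx_ext (h'.1.symm.trans h.1) (by omega))
  · simp

lemma exists_isSuperdiag {p : Idx n} (hp : codist n p ≠ 0) : ∃ q, IsSuperdiag n p q := by
  obtain ⟨q, hq, hq'⟩ := exists_idx (n := n) p.1 (m := codist n p - 1)
    (by have := codist_lt p; omega)
  exact ⟨q, isSuperdiag_iff.2 ⟨hq.symm, by omega⟩⟩

lemma B0_apply (p : Idx n) (i : Fin r) :
    B0 n p i = if p.1 = i ∧ codist n p = 0 then 1 else 0 := by
  simp only [B0, Matrix.of_apply, last_iff]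

lemma A0_pow_mul_B0_apply (j : ℕ) (p : Idx n) (i : Fin r) :
    (A0 n ^ j * B0 n) p i = if p.1 = i ∧ codist n p = j then 1 else 0 := by
  induction j generalizing p with
  | zero => rw [pow_zero, Matrix.one_mul, B0_apply]
  | succ j ih =>
    rw [pow_succ', Matrix.mul_assoc]
    by_cases hp : codist n p = 0
    · rw [A0_mul_apply_of_codist_eq_zero _ hp, if_neg]
      omega
    · obtain ⟨q, hq⟩ := exists_isSuperdiag hp
      rw [A0_mul_apply_of_isSuperdiag _ hq, ih]
      rw [isSuperdiag_iff] at hq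
      refine if_congr ?_ rfl rfl
      rw [hq.1, hq.2]
      simp

variable (n) in
/-- The matrix `e^{-A₀ t} B₀`. -/
noncomputable def expB (t : ℝ) : Matrix (Idx n) (Fin r) ℝ :=
  Matrix.of fun p i => if p.1 = i then (-t) ^ codist n p / (codist n p).factorial else 0

section

attribute [local instance] Matrix.linftyOpNormedRing Matrix.linftyOpNormedAlgebra

/-- Since A₀ʲB₀ lives on the coordinates at distance j from the block ends, each entry of the
exponential series has at most one nonzero term. -/
lemma exp_mul_B0 (t : ℝ) : NormedSpace.exp (-(t • A0 n)) * B0 n = expB n t := by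
  have h := NormedSpace.exp_series_hasSum_exp' (𝕂 := ℝ) (-(t • A0 n))
  ext p i
  have h2 : HasSum (fun j : ℕ => (((j.factorial : ℝ)⁻¹ • (-(t • A0 n)) ^ j) * B0 n) p i)
      ((NormedSpace.exp (-(t • A0 n)) * B0 n) p i) := by
    have hc : Continuous fun X : Matrix (Idx n) (Idx n) ℝ => (X * B0 n) p i := by
      fun_prop
    exact h.map ({ toFun := fun X : Matrix (Idx n) (Idx n) ℝ => (X * B0 n) p i
                   map_zero' := by simp
                   map_add' := fun X Y => by simp [Matrix.add_mul] } :
                     Matrix (Idx n) (Idx n) ℝ →+ ℝ) hc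
  refine h2.unique ?_
  have h3 : ∀ j : ℕ, (((j.factorial : ℝ)⁻¹ • (-(t • A0 n)) ^ j) * B0 n) p i
      = if j = codist n p then expB n t p i else 0 := by
    intro j
    rw [← neg_smul, smul_pow, smul_smul, Matrix.smul_mul, Matrix.smul_apply, A0_pow_mul_B0_apply,
      smul_eq_mul]
    by_cases hj : j = codist n p
    · subst hj
      by_cases hi : p.1 = i
      · simp [expB, hi]
        ring
      · simp [expB, hi]
    · rw [if_neg hj, if_neg (fun h => hj h.2.symm), mul_zero]
  simp only [h3]
  exact hasSum_ite_eq _ _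

end

/-! ### Gram matrices and controllability -/

variable (n) in
/-- The Gram matrix `∫₀¹ w(t) e^{-A₀ t} B₀ B₀* e^{-A₀* t} dt`. -/
noncomputable def gram (w : ℝ → ℝ) : Matrix (Idx n) (Idx n) ℝ :=
  Matrix.of fun p q => ∫ t in (0 : ℝ)..1, w t * (expB n t * (expB n t)ᵀ) p q

lemma Finv_eq_gram : Finv n = gram n (fun t => 1 - t) := by
  ext p q
  simp only [Finv, gram, Matrix.of_apply]
  congr 1
  ext t
  congr 2
  rw [← exp_mul_B0, Matrix.transpose_mul, Matrix.mul_assoc, Matrix.mul_assoc, Matrix.mul_assoc]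
  rw [← Matrix.exp_transpose, Matrix.transpose_neg, Matrix.transpose_smul]

lemma continuous_expB_apply (p : Idx n) (i : Fin r) : Continuous fun t => expB n t p i := by
  simp only [expB, Matrix.of_apply]
  split_ifs <;> fun_prop

lemma continuous_expB_mul_apply (p q : Idx n) :
    Continuous fun t => (expB n t * (expB n t)ᵀ) p q := by
  simp only [Matrix.mul_apply, Matrix.transpose_apply]
  exact continuous_finsetSum _ fun i _ =>
    (continuous_expB_apply p i).mul (continuous_expB_apply q i)

lemma gram_quad {w : ℝ → ℝ} (hw : Continuous w) (x : Idx n → ℝ) :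
    x ⬝ᵥ (gram n w *ᵥ x)
      = ∫ t in (0 : ℝ)..1, w t * (((expB n t)ᵀ *ᵥ x) ⬝ᵥ ((expB n t)ᵀ *ᵥ x)) := by
  have h : ∀ t, w t * (((expB n t)ᵀ *ᵥ x) ⬝ᵥ ((expB n t)ᵀ *ᵥ x))
      = ∑ p, ∑ q, x p * (x q * (w t * (expB n t * (expB n t)ᵀ) p q)) := by
    intro t
    have : ((expB n t)ᵀ *ᵥ x) ⬝ᵥ ((expB n t)ᵀ *ᵥ x)
        = x ⬝ᵥ ((expB n t * (expB n t)ᵀ) *ᵥ x) := by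
      rw [← Matrix.mulVec_mulVec, Matrix.dotProduct_mulVec x, ← Matrix.mulVec_transpose]
    rw [this]
    simp only [dotProduct, Matrix.mulVec, Finset.mul_sum]
    refine Finset.sum_congr rfl fun p _ => Finset.sum_congr rfl fun q _ => by ring
  simp only [h]
  have hc : ∀ p q, Continuous fun t => x p * (x q * (w t * (expB n t * (expB n t)ᵀ) p q)) :=
    fun p q => continuous_const.mul (continuous_const.mul
      (hw.mul (continuous_expB_mul_apply p q)))
  rw [intervalIntegral.integral_finsetSum fun p _ =>
    (continuous_finsetSum _ fun q _ => hc p q).intervalIntegrable _ _]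
  simp only [dotProduct, Matrix.mulVec, Finset.mul_sum]
  refine Finset.sum_congr rfl fun p _ => ?_
  rw [intervalIntegral.integral_finsetSum fun q _ => (hc p q).intervalIntegrable _ _]
  refine Finset.sum_congr rfl fun q _ => ?_
  simp only [gram, Matrix.of_apply, intervalIntegral.integral_const_mul]
  ring

/-- Controllability of (A₀, B₀). The i-th component is a polynomial in t whose coefficients are, up
to nonzero factors, the coordinates of x in block i; if it vanishes on an interval, all of them
vanish. -/
lemma exists_expB_mulVec_ne_zero {x : Idx n → ℝ} (hx : x ≠ 0) :
    ∃ t ∈ Ico (0 : ℝ) 1, (expB n t)ᵀ *ᵥ x ≠ 0 := by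
  by_contra! hcon
  apply hx
  ext p
  let P : Polynomial ℝ := ∑ q : Idx n, if q.1 = p.1 then
    Polynomial.monomial (codist n q) ((-1) ^ codist n q / (codist n q).factorial * x q) else 0
  have hP : P = 0 := by
    refine Polynomial.eq_zero_of_infinite_isRoot P ((Ico_infinite (zero_lt_one' ℝ)).mono ?_)
    intro t ht
    have h := congrFun (hcon t ht) p.1
    simp only [Matrix.mulVec, dotProduct, Matrix.transpose_apply, expB, Matrix.of_apply,
      Pi.zero_apply] at h
    change P.eval t = 0
    rw [← h]
    simp only [P, Polynomial.eval_finsetSum]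
    refine Finset.sum_congr rfl fun q _ => ?_
    split_ifs
    · rw [Polynomial.eval_monomial, neg_pow t]
      ring
    · simp
  have h := congrArg (fun P => P.coeff (codist n p)) hP
  simp only [P, Polynomial.finsetSum_coeff, Polynomial.coeff_zero] at h
  rw [Finset.sum_eq_single p] at h
  · rw [if_pos rfl, Polynomial.coeff_monomial, if_pos rfl] at h
    have h1 : ((-1 : ℝ)) ^ codist n p / (codist n p).factorial ≠ 0 := by positivity
    simpa [h1] using h
  · intro q _ hq
    split_ifs with hi
    · rw [Polynomial.coeff_monomial, if_neg]
      exact fun h => hq (idx_ext hi h)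
    · simp
  · simp

/-- Positivity is asked only on [0, 1) because the weight 1 - t of `Finv` vanishes at 1. -/
lemma gram_posDef {w : ℝ → ℝ} (hw : Continuous w) (hw0 : ∀ t ∈ Ico (0 : ℝ) 1, 0 < w t) :
    (gram n w).PosDef := by
  refine Matrix.PosDef.of_dotProduct_mulVec_pos ?_ fun x hx => ?_
  · ext p q
    simp only [gram, Matrix.of_apply, Matrix.conjTranspose_apply, star_trivial]
    congr 1
    ext t
    congr 1
    rw [← Matrix.transpose_apply (expB n t * (expB n t)ᵀ), Matrix.transpose_mul,
      Matrix.transpose_transpose]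
  · rw [star_trivial, gram_quad hw]
    have hw1 : 0 ≤ w 1 := by
      have h : Tendsto w (𝓝[<] 1) (𝓝 (w 1)) := hw.continuousAt.tendsto.mono_left inf_le_left
      refine ge_of_tendsto h ?_
      filter_upwards [Ico_mem_nhdsLT (zero_lt_one' ℝ)] with t ht using (hw0 t ht).le
    have hwn : ∀ t ∈ Icc (0 : ℝ) 1, 0 ≤ w t := by
      intro t ht
      rcases ht.2.eq_or_lt with rfl | h
      · exact hw1
      · exact (hw0 t ⟨ht.1, h⟩).le
    have hn : ∀ v : Fin r → ℝ, 0 ≤ v ⬝ᵥ v := fun v =>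
      Finset.sum_nonneg fun i _ => mul_self_nonneg _
    obtain ⟨t, ht, htx⟩ := exists_expB_mulVec_ne_zero hx
    refine intervalIntegral.integral_pos zero_lt_one ?_ ?_ ⟨t, Ico_subset_Icc_self ht, ?_⟩
    · refine (hw.mul ?_).continuousOn
      simp only [dotProduct, Matrix.mulVec, Matrix.transpose_apply]
      have : ∀ i, Continuous fun t => ∑ p, expB n t p i * x p := fun i =>
        continuous_finsetSum _ fun p _ => (continuous_expB_apply p i).mul continuous_const
      exact continuous_finsetSum _ fun i _ => (this i).mul (this i)
    · exact fun s hs => mul_nonneg (hwn s (Ioc_subset_Icc_self hs)) (hn _)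
    · refine mul_pos (hw0 t ht) ((hn _).lt_of_ne' ?_)
      rwa [Ne, dotProduct_self_eq_zero]

lemma Finv_posDef : (Finv n).PosDef := by
  rw [Finv_eq_gram]
  exact gram_posDef (by fun_prop) fun t ht => by linarith [ht.2]

/-! ### Explicit entries; the Lyapunov and Riccati equations -/

lemma expB_mul_apply (t : ℝ) (p q : Idx n) : (expB n t * (expB n t)ᵀ) p q =
    if p.1 = q.1 then (-1 : ℝ) ^ (codist n p + codist n q) /
      ((codist n p).factorial * (codist n q).factorial) * t ^ (codist n p + codist n q) else 0 := by
  simp only [Matrix.mul_apply, Matrix.transpose_apply, expB, Matrix.of_apply]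
  rw [Finset.sum_eq_single q.1]
  · rw [if_pos rfl]
    split_ifs
    · rw [neg_pow t, neg_pow t, pow_add, pow_add]
      field_simp
    · rw [zero_mul]
  · intro i _ hi
    rw [if_neg hi.symm, mul_zero]
  · simp

lemma gram_one_apply (p q : Idx n) : gram n (fun _ => 1) p q =
    if p.1 = q.1 then (-1 : ℝ) ^ (codist n p + codist n q) /
      ((codist n p).factorial * (codist n q).factorial * (codist n p + codist n q + 1)) else 0 := by
  simp only [gram, Matrix.of_apply, expB_mul_apply]
  split_ifs
  · simp only [one_mul, intervalIntegral.integral_const_mul, integral_pow]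
    push_cast
    simp
    field_simp
  · simp

lemma Finv_apply (p q : Idx n) : Finv n p q =
    if p.1 = q.1 then (-1 : ℝ) ^ (codist n p + codist n q) /
      ((codist n p).factorial * (codist n q).factorial *
        ((codist n p + codist n q + 1) * (codist n p + codist n q + 2))) else 0 := by
  rw [Finv_eq_gram]
  simp only [gram, Matrix.of_apply, expB_mul_apply]
  split_ifs
  · set M := codist n p + codist n q with hM
    have h : ∀ t : ℝ, (1 - t) * ((-1) ^ M / ((codist n p).factorial * (codist n q).factorial)
        * t ^ M) = (-1) ^ M / ((codist n p).factorial * (codist n q).factorial)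
        * (t ^ M - t ^ (M + 1)) := fun t => by ring
    simp only [h, intervalIntegral.integral_const_mul]
    rw [intervalIntegral.integral_sub (by simp) (by simp), integral_pow, integral_pow, hM]
    push_cast
    simp
    field_simp
    ring
  · simp

lemma Finv_isSymm (p q : Idx n) : Finv n p q = Finv n q p := by
  have := congrFun (congrFun Finv_posDef.isHermitian q) p
  simpa using this

lemma Finv_mul_F : Finv n * F n = 1 :=
  Matrix.mul_nonsing_inv _ ((Matrix.isUnit_iff_isUnit_det _).1 Finv_posDef.isUnit)

lemma F_mul_Finv : F n * Finv n = 1 :=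
  Matrix.nonsing_inv_mul _ ((Matrix.isUnit_iff_isUnit_det _).1 Finv_posDef.isUnit)

lemma F_posDef : (F n).PosDef := Finv_posDef.inv

lemma F_transpose : (F n)ᵀ = F n := by
  have h := (F_posDef (n := n)).isHermitian
  rwa [Matrix.IsHermitian, Matrix.conjTranspose_eq_transpose_of_trivial] at h

/-- The right-hand side multiplies the (p, q) entry by 1 + `expo n p` + `expo n q` = `codist n p` +
`codist n q` + 2. This cancels the extra factor that the weight 1 - t puts in the denominator. -/
lemma gram_one_eq : gram n (fun _ => 1) = Finv n - H n * Finv n - Finv n * H n := by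
  ext p q
  rw [Matrix.sub_apply, Matrix.sub_apply, H, Matrix.diagonal_mul, Matrix.mul_diagonal,
    gram_one_apply, Finv_apply, expo_eq, expo_eq]
  split_ifs
  · have h1 : (codist n p + codist n q + 1 : ℝ) ≠ 0 := by positivity
    have h2 : (codist n p + codist n q + 2 : ℝ) ≠ 0 := by positivity
    field_simp
    ring
  · simp

lemma B0_mul_transpose_apply (p q : Idx n) :
    (B0 n * (B0 n)ᵀ) p q = if p.1 = q.1 ∧ codist n p = 0 ∧ codist n q = 0 then 1 else 0 := by
  simp only [Matrix.mul_apply, Matrix.transpose_apply, B0_apply]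
  rw [Finset.sum_eq_single q.1]
  · by_cases h1 : codist n p = 0 <;> by_cases h2 : codist n q = 0 <;> simp [h1, h2]
  · intro i _ hi
    rw [if_neg (fun h : q.1 = i ∧ _ => hi h.1.symm), mul_zero]
  · simp

lemma A0_mul_Finv_apply (p q : Idx n) : (A0 n * Finv n) p q =
    if p.1 = q.1 then -(-1 : ℝ) ^ (codist n p + codist n q) * codist n p /
      ((codist n p).factorial * (codist n q).factorial *
        ((codist n p + codist n q) * (codist n p + codist n q + 1))) else 0 := by
  by_cases hp : codist n p = 0
  -- In the last row of a block the numerator is 0, so the formula stays valid even when its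
  -- denominator is 0 as well.
  · rw [A0_mul_apply_of_codist_eq_zero _ hp, hp]
    simp
  · obtain ⟨p', hp'⟩ := exists_isSuperdiag hp
    rw [A0_mul_apply_of_isSuperdiag _ hp', Finv_apply]
    rw [isSuperdiag_iff] at hp'
    rw [hp'.1, hp'.2, Nat.factorial_succ]
    split_ifs
    · push_cast
      have h1 : (codist n p' + codist n q + 1 : ℝ) ≠ 0 := by positivity
      have h2 : (codist n p' + codist n q + 2 : ℝ) ≠ 0 := by positivity
      have h3 : (codist n p' + 1 : ℝ) ≠ 0 := by positivity
      have h4 : (codist n p' + 1 + codist n q : ℝ) = codist n p' + codist n q + 1 := by ring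
      rw [h4]
      field_simp
      ring
    · rfl

/-- The Lyapunov equation for `F⁻¹`. -/
lemma lyapunov_Finv :
    A0 n * Finv n + Finv n * (A0 n)ᵀ - B0 n * (B0 n)ᵀ = -gram n (fun _ => 1) := by
  ext p q
  have hs : (Finv n * (A0 n)ᵀ) p q = (A0 n * Finv n) q p := by
    rw [Matrix.mul_apply, Matrix.mul_apply]
    refine Finset.sum_congr rfl fun s _ => ?_
    rw [Matrix.transpose_apply, Finv_isSymm p s, mul_comm]
  rw [Matrix.sub_apply, Matrix.add_apply, hs, A0_mul_Finv_apply, A0_mul_Finv_apply,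
    B0_mul_transpose_apply, Matrix.neg_apply, gram_one_apply]
  by_cases h : p.1 = q.1
  · rw [if_pos h, if_pos h.symm, if_pos h]
    -- Only in this corner does B₀B₀* contribute. Elsewhere the two numerators add up to the sum of
    -- the codistances, which cancels.
    by_cases h0 : codist n p = 0 ∧ codist n q = 0
    · simp [h0.1, h0.2, h]
    · rw [if_neg (by tauto)]
      have h1 : (codist n p + codist n q : ℝ) ≠ 0 := by
        have : codist n p + codist n q ≠ 0 := by omega
        exact_mod_cast this
      have h2 : (codist n p + codist n q + 1 : ℝ) ≠ 0 := by positivity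
      rw [add_comm (codist n q), add_comm (codist n q : ℝ)]
      field_simp
      ring
  · simp [h, Ne.symm h]

/-- This exhibits F¹ as a congruence of the unweighted Gram matrix, whence its positive
definiteness. -/
lemma F1_eq : F1 n = F n * gram n (fun _ => 1) * F n := by
  rw [gram_one_eq, Matrix.mul_sub, Matrix.mul_sub, Matrix.sub_mul, Matrix.sub_mul, F_mul_Finv,
    Matrix.one_mul, ← Matrix.mul_assoc, ← Matrix.mul_assoc, F_mul_Finv, Matrix.one_mul,
    Matrix.mul_assoc (F n * H n), Finv_mul_F, Matrix.mul_one, F1]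

lemma F1_posDef : (F1 n).PosDef := by
  have h : (gram n (fun _ => 1)).PosDef := gram_posDef (by fun_prop) fun t _ => zero_lt_one
  have h2 := h.mul_mul_conjTranspose_same (B := F n)
    (Matrix.vecMul_injective_iff_isUnit.2 F_posDef.isUnit)
  rwa [F_posDef.isHermitian, ← F1_eq] at h2

/-- The Riccati equation for `F`. -/
lemma riccati_F :
    F n * A0 n + (A0 n)ᵀ * F n - F n * (B0 n * (B0 n)ᵀ) * F n = -F1 n := by
  have h := congrArg (fun X => F n * X * F n) (lyapunov_Finv (n := n))
  rw [Matrix.mul_neg, Matrix.neg_mul, ← F1_eq, Matrix.mul_sub, Matrix.mul_add, Matrix.sub_mul,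
    Matrix.add_mul, ← Matrix.mul_assoc (F n) (A0 n), Matrix.mul_assoc (F n * A0 n), Finv_mul_F,
    Matrix.mul_one, ← Matrix.mul_assoc (F n) (Finv n), F_mul_Finv, Matrix.one_mul] at h
  exact h

/-! ### Entrywise nonnegativity of F through orthogonal polynomials -/

lemma sum_block (i : Fin r) (f : ℕ → ℝ) :
    ∑ q : Idx n, (if q.1 = i then f (codist n q) else 0) = ∑ m ∈ Finset.range (n i), f m := by
  rw [Fintype.sum_sigma, Finset.sum_eq_single i]
  · simp only [if_true, codist]
    rw [Fin.sum_univ_eq_sum_range (fun j => f (n i - 1 - j)), Finset.sum_range_reflect]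
  · intro j _ hj
    simp [hj]
  · simp

/-- Since ∫₀¹ (1 - t)t^{j+m} dt = 1/((j+m+1)(j+m+2)), this is the orthogonality of a degree k Jacobi
polynomial to tᵐ. The second binomial is (j+1)⋯(j+k+1)/(k+1)!, whose factors include j+m+1 and
j+m+2. What is left after division is a polynomial in j of degree k - 1, and its k-th finite
difference vanishes. -/
lemma sum_choose_mul_choose_div_eq_zero {k m : ℕ} (hm : m < k) :
    ∑ j ∈ Finset.range (k + 1), (-1 : ℝ) ^ j * k.choose j * (k + j + 1).choose j /
      ((j + m + 1) * (j + m + 2)) = 0 := by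
  let s := ((Finset.range (k + 1)).erase m).erase (m + 1)
  let P : Polynomial ℝ := ∏ a ∈ s, (Polynomial.X + Polynomial.C (a + 1 : ℝ))
  have hmem : m ∈ Finset.range (k + 1) := by simp; omega
  have hmem' : m + 1 ∈ (Finset.range (k + 1)).erase m := by simp; omega
  have hP : P.natDegree < k := by
    have h1 : P.natDegree ≤ ∑ a ∈ s, 1 :=
      (Polynomial.natDegree_prod_le _ _).trans
        (Finset.sum_le_sum fun a _ => (Polynomial.natDegree_X_add_C _).le)
    have h2 : s.card = k - 1 := by
      rw [Finset.card_erase_of_mem hmem', Finset.card_erase_of_mem hmem, Finset.card_range]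
      omega
    rw [Finset.sum_const, smul_eq_mul, mul_one, h2] at h1
    omega
  have hPj : ∀ j : ℕ, (((k + j + 1).choose j : ℕ) : ℝ) / ((j + m + 1) * (j + m + 2))
      = P.eval (j : ℝ) / (k + 1).factorial := by
    intro j
    have h1 : (((j + 1).ascFactorial (k + 1) : ℕ) : ℝ)
        = (j + m + 1) * ((j + m + 2) * P.eval (j : ℝ)) := by
      rw [Nat.ascFactorial_eq_prod_range, Nat.cast_prod, ← Finset.mul_prod_erase _ _ hmem,
        ← Finset.mul_prod_erase _ _ hmem', Polynomial.eval_prod]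
      push_cast
      congr 1
      · ring
      congr 1
      · ring
      refine Finset.prod_congr rfl fun a _ => ?_
      simp
      ring
    have h2 := Nat.ascFactorial_eq_factorial_mul_choose' (j + 1) (k + 1)
    have h3 : (k + j + 1).choose j = (j + 1 + (k + 1) - 1).choose (k + 1) := by
      rw [← Nat.choose_symm (by omega)]
      congr 1 <;> omega
    rw [h3]
    rw [h2] at h1
    push_cast at h1
    have h4 : ((k + 1).factorial : ℝ) ≠ 0 := by positivity
    have h5 : (j + m + 1 : ℝ) ≠ 0 := by positivity
    have h6 : (j + m + 2 : ℝ) ≠ 0 := by positivity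
    rw [div_eq_div_iff (by positivity) h4, mul_comm, h1]
    ring
  have h0 := congrFun (Polynomial.fwdDiff_iter_eq_zero_of_degree_lt hP) 0
  rw [fwdDiff_iter_eq_sum_shift] at h0
  simp only [Pi.zero_apply, zero_add, mul_one, zsmul_eq_mul, nsmul_eq_mul] at h0
  have h7 : ∀ j ∈ Finset.range (k + 1), (-1 : ℝ) ^ j * k.choose j * (k + j + 1).choose j /
      ((j + m + 1) * (j + m + 2)) = (-1) ^ k / (k + 1).factorial *
      (((((-1 : ℤ) ^ (k - j) * (k.choose j : ℕ) : ℤ)) : ℝ) * P.eval (j : ℝ)) := by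
    intro j hj
    rw [mul_div_assoc, hPj]
    push_cast
    have h8 : (-1 : ℝ) ^ k * (-1) ^ (k - j) = (-1) ^ j := by
      have : k = (k - j) + j := by simp at hj; omega
      conv_lhs => rw [this]
      rw [Nat.add_sub_cancel, pow_add, mul_right_comm, ← mul_pow]
      simp
    rw [← h8]
    ring
  rw [Finset.sum_congr rfl h7, ← Finset.mul_sum, h0, mul_zero]

variable (n) in
/-- The coefficients of the orthogonal polynomials of the weight `1 - t`; a triangular matrix that
diagonalizes the quadratic form of `F⁻¹`. -/
noncomputable def orthoCoeff : Matrix (Idx n) (Idx n) ℝ :=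
  Matrix.of fun p q => if p.1 = q.1 then ((codist n p).choose (codist n q) : ℝ) *
    (codist n p + codist n q + 1).choose (codist n q) * (codist n q).factorial else 0

lemma orthoCoeff_apply (p q : Idx n) : orthoCoeff n p q =
    if p.1 = q.1 then ((codist n p).choose (codist n q) : ℝ) *
    (codist n p + codist n q + 1).choose (codist n q) * (codist n q).factorial else 0 := rfl

lemma orthoCoeff_nonneg (p q : Idx n) : 0 ≤ orthoCoeff n p q := by
  rw [orthoCoeff_apply]
  split_ifs <;> positivity

lemma orthoCoeff_eq_zero {p q : Idx n} (h : p.1 = q.1 → codist n p < codist n q) :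
    orthoCoeff n p q = 0 := by
  rw [orthoCoeff_apply]
  split_ifs with h1
  · rw [Nat.choose_eq_zero_of_lt (h h1)]
    simp
  · rfl

/-- The rows of `orthoCoeff` carry no signs: the alternating signs and factorials of the orthogonal
polynomials are supplied by the entries (-t)ʲ/j! of e^{-A₀t}B₀. This is what makes F nonnegative in
the end. -/
lemma orthoCoeff_mul_Finv_eq_zero {p q : Idx n} (h : p.1 = q.1 → codist n q < codist n p) :
    (orthoCoeff n * Finv n) p q = 0 := by
  rw [Matrix.mul_apply]
  by_cases hi : p.1 = q.1
  · let g : ℕ → ℝ := fun j => (-1) ^ codist n q / (codist n q).factorial * ((-1) ^ j *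
      (codist n p).choose j * (codist n p + j + 1).choose j /
      ((j + codist n q + 1) * (j + codist n q + 2)))
    have h1 : ∀ s : Idx n, orthoCoeff n p s * Finv n s q =
        if s.1 = q.1 then g (codist n s) else 0 := by
      intro s
      simp only [g]
      rw [orthoCoeff_apply, Finv_apply]
      split_ifs with h1 h2 h2
      · have h3 : (codist n s + codist n q + 1 : ℝ) ≠ 0 := by positivity
        have h4 : (codist n s + codist n q + 2 : ℝ) ≠ 0 := by positivity
        have h5 : ((codist n s).factorial : ℝ) ≠ 0 := by positivity
        have h6 : ((codist n q).factorial : ℝ) ≠ 0 := by positivity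
        rw [pow_add]
        field_simp
      · rw [mul_zero]
      · exact absurd (hi.trans h2.symm) h1
      · rw [mul_zero]
    rw [Finset.sum_congr rfl fun s _ => h1 s, sum_block q.1 g, ← Finset.mul_sum]
    have h2 : Finset.range (codist n p + 1) ⊆ Finset.range (n q.1) := by
      rw [Finset.range_subset_range]
      have := codist_lt p
      rwa [hi] at this
    rw [← Finset.sum_subset h2, sum_choose_mul_choose_div_eq_zero (h hi), mul_zero]
    intro j _ hj
    rw [Nat.choose_eq_zero_of_lt (by simpa using hj)]
    simp
  · refine Finset.sum_eq_zero fun s _ => ?_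
    rw [orthoCoeff_apply, Finv_apply]
    split_ifs with h1 h2
    · exact absurd (h1.trans h2) hi
    all_goals simp

lemma orthoCoeff_diagonalizes :
    ∃ d : Idx n → ℝ, orthoCoeff n * Finv n * (orthoCoeff n)ᵀ = Matrix.diagonal d := by
  -- Orthogonality kills the entries with `codist n q` < `codist n p` and those between different
  -- blocks; symmetry then kills the other off-diagonal ones.
  have key : ∀ p q : Idx n, (p.1 = q.1 → codist n q < codist n p) →
      (orthoCoeff n * Finv n * (orthoCoeff n)ᵀ) p q = 0 := by
    intro p q h
    rw [Matrix.mul_apply]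
    refine Finset.sum_eq_zero fun s _ => ?_
    rw [Matrix.transpose_apply]
    by_cases h1 : p.1 = s.1 → codist n s < codist n p
    · rw [orthoCoeff_mul_Finv_eq_zero h1, zero_mul]
    · push Not at h1
      rw [orthoCoeff_eq_zero (p := q), mul_zero]
      intro h2
      have := h (h1.1.trans h2.symm)
      omega
  have hsymm : (orthoCoeff n * Finv n * (orthoCoeff n)ᵀ)ᵀ
      = orthoCoeff n * Finv n * (orthoCoeff n)ᵀ := by
    have h : (Finv n)ᵀ = Finv n := by
      ext p q
      exact Finv_isSymm q p
    rw [Matrix.transpose_mul, Matrix.transpose_mul, Matrix.transpose_transpose, h,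
      Matrix.mul_assoc]
  refine ⟨Matrix.diag (orthoCoeff n * Finv n * (orthoCoeff n)ᵀ), ?_⟩
  ext p q
  by_cases hpq : p = q
  · subst hpq
    simp
  · rw [Matrix.diagonal_apply_ne _ hpq]
    by_cases h : p.1 = q.1 → codist n q < codist n p
    · exact key p q h
    · rw [← hsymm, Matrix.transpose_apply]
      push Not at h
      exact key q p fun _ => h.2.lt_of_ne fun h3 => hpq (idx_ext h.1 h3)

/-- Triangular with nonzero diagonal: at a coordinate of maximal codistance where x and y differ,
only the diagonal term survives. -/
lemma isUnit_orthoCoeff : IsUnit (orthoCoeff n) := by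
  rw [← Matrix.vecMul_injective_iff_isUnit]
  intro x y hxy
  by_contra hne
  obtain ⟨p, hp, hmax⟩ := Finset.exists_max_image
    (Finset.univ.filter fun p : Idx n => x p ≠ y p) (codist n) (by
      by_contra h
      rw [Finset.not_nonempty_iff_eq_empty] at h
      exact hne (funext fun p => by
        by_contra h2
        exact (Finset.notMem_empty p) (h ▸ (by simpa using h2))))
  have h := congrFun hxy p
  simp only [Matrix.vecMul, dotProduct] at h
  rw [← sub_eq_zero, ← Finset.sum_sub_distrib, Finset.sum_eq_single p] at h
  · rw [orthoCoeff_apply, if_pos rfl, ← sub_mul] at h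
    simp only [Finset.mem_filter, Finset.mem_univ, true_and] at hp
    refine (mul_ne_zero (sub_ne_zero.2 hp) ?_) h
    have : 0 < (codist n p + codist n p + 1).choose (codist n p) := Nat.choose_pos (by omega)
    rw [Nat.choose_self]
    positivity
  · intro q _ hq
    by_cases hxq : x q = y q
    · rw [hxq, sub_self]
    · have h1 := hmax q (by simpa using hxq)
      rw [orthoCoeff_eq_zero, mul_zero, mul_zero, sub_zero]
      exact fun h2 => h1.lt_of_ne fun h3 => hq (idx_ext h2 h3)
  · simp

lemma F_nonneg (p q : Idx n) : 0 ≤ F n p q := by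
  obtain ⟨d, hd⟩ := orthoCoeff_diagonalizes (n := n)
  have hpos := Finv_posDef.mul_mul_conjTranspose_same (B := orthoCoeff n)
    (Matrix.vecMul_injective_iff_isUnit.2 isUnit_orthoCoeff)
  rw [Matrix.conjTranspose_eq_transpose_of_trivial, hd, Matrix.posDef_diagonal_iff] at hpos
  have hF : F n = (orthoCoeff n)ᵀ * Matrix.diagonal (fun i => (d i)⁻¹) * orthoCoeff n := by
    refine Matrix.inv_eq_left_inv ?_
    have hu : IsUnit (orthoCoeff n)ᵀ := (Matrix.isUnit_transpose _).2 isUnit_orthoCoeff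
    refine hu.mul_left_injective ?_
    simp only
    rw [Matrix.mul_assoc, Matrix.mul_assoc, ← Matrix.mul_assoc (orthoCoeff n), hd,
      Matrix.mul_assoc, Matrix.diagonal_mul_diagonal, Matrix.one_mul]
    have : (fun i => (d i)⁻¹ * d i) = fun _ => 1 := funext fun i => inv_mul_cancel₀ (hpos i).ne'
    rw [this, Matrix.diagonal_one, Matrix.mul_one]
  rw [hF, Matrix.mul_apply]
  refine Finset.sum_nonneg fun s _ => ?_
  rw [Matrix.mul_diagonal, Matrix.transpose_apply]
  exact mul_nonneg (mul_nonneg (orthoCoeff_nonneg _ _) (inv_nonneg.2 (hpos s).le))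
    (orthoCoeff_nonneg _ _)

/-! ### A lower bound for the spectral radius of a nonnegative matrix -/

section SpectralRadius

variable {ι : Type} [Fintype ι] [DecidableEq ι]

lemma specRad_nonneg (A : Matrix ι ι ℝ) : 0 ≤ specRad A := ENNReal.toReal_nonneg

lemma pow_smul_le_pow_mulVec {A : Matrix ι ι ℝ} (hA : ∀ i j, 0 ≤ A i j) {z : ι → ℝ} {μ : ℝ}
    (hμ : 0 ≤ μ) (h : ∀ i, μ * z i ≤ (A *ᵥ z) i) (k : ℕ) (i : ι) :
    μ ^ k * z i ≤ (A ^ k *ᵥ z) i := by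
  induction k generalizing i with
  | zero => simp
  | succ k ih =>
    rw [pow_succ' A, ← Matrix.mulVec_mulVec]
    calc μ ^ (k + 1) * z i = μ ^ k * (μ * z i) := by ring
      _ ≤ μ ^ k * (A *ᵥ z) i := by gcongr; exact h i
      _ = ∑ j, A i j * (μ ^ k * z j) := by
        rw [Matrix.mulVec, dotProduct, Finset.mul_sum]
        exact Finset.sum_congr rfl fun j _ => by ring
      _ ≤ _ := Finset.sum_le_sum fun j _ => mul_le_mul_of_nonneg_left (ih j) (hA i j)

attribute [local instance] Matrix.linftyOpNormedRing Matrix.linftyOpNormedAlgebra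

/-- The Collatz–Wielandt lower bound for the spectral radius of a nonnegative matrix. -/
lemma le_specRad {A : Matrix ι ι ℝ} (hA : ∀ i j, 0 ≤ A i j) {z : ι → ℝ} (hz : ∀ i, 0 ≤ z i)
    (hz0 : z ≠ 0) {μ : ℝ} (hμ : 0 ≤ μ) (h : ∀ i, μ * z i ≤ (A *ᵥ z) i) : μ ≤ specRad A := by
  have : CompleteSpace (Matrix ι ι ℂ) := FiniteDimensional.complete ℂ _
  obtain ⟨i₀, hi₀⟩ := Function.ne_iff.1 hz0
  have : Nonempty ι := ⟨i₀⟩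
  set a : Matrix ι ι ℂ := A.map (fun a : ℝ => (a : ℂ)) with ha
  let w : ι → ℂ := fun i => (z i : ℂ)
  have hw : 0 < ‖w‖ := by
    rw [norm_pos_iff]
    intro h0
    have := congrFun h0 i₀
    simp only [w, Pi.zero_apply, Complex.ofReal_eq_zero] at this
    exact hi₀ this
  have hpow : ∀ k, a ^ k = (A ^ k).map (fun a : ℝ => (a : ℂ)) := fun k =>
    (map_pow (Complex.ofRealHom.mapMatrix (m := ι)) A k).symm
  -- Iterating Az ≥ μz gives Aᵏz ≥ μᵏz, so testing on z bounds the norm from below; Gelfand's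
  -- formula then passes to the spectral radius.
  have hnorm : ∀ k, μ ^ k ≤ ‖a ^ k‖ := by
    intro k
    refine le_of_mul_le_mul_right ?_ hw
    refine le_trans ?_ (Matrix.linfty_opNorm_mulVec (a ^ k) w)
    have h1 : μ ^ k * ‖w‖ = ‖(μ ^ k) • w‖ := by
      rw [norm_smul, Real.norm_of_nonneg (by positivity)]
    rw [h1, pi_norm_le_iff_of_nonneg (norm_nonneg _)]
    intro i
    refine le_trans ?_ (norm_le_pi_norm _ i)
    have h2 : ((a ^ k) *ᵥ w) i = (((A ^ k *ᵥ z) i : ℝ) : ℂ) := by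
      rw [hpow]
      simp [Matrix.mulVec, dotProduct, w]
    rw [h2, Complex.norm_real, Pi.smul_apply, norm_smul, Complex.norm_real,
      Real.norm_of_nonneg (by positivity : 0 ≤ μ ^ k), Real.norm_of_nonneg (hz i)]
    exact (pow_smul_le_pow_mulVec hA hμ h k i).trans (le_abs_self _)
  have hlim := spectrum.pow_nnnorm_pow_one_div_tendsto_nhds_spectralRadius a
  have hle : ENNReal.ofReal μ ≤ spectralRadius ℂ a := by
    refine ge_of_tendsto hlim ?_
    filter_upwards [eventually_ge_atTop 1] with k hk
    have h1 : ENNReal.ofReal μ ^ k ≤ (‖a ^ k‖₊ : ENNReal) := by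
      rw [← ENNReal.ofReal_pow hμ, ← enorm_eq_nnnorm, ← ofReal_norm]
      exact ENNReal.ofReal_le_ofReal (hnorm k)
    calc ENNReal.ofReal μ = (ENNReal.ofReal μ ^ k) ^ (1 / k : ℝ) := by
          rw [← ENNReal.rpow_natCast, ← ENNReal.rpow_mul, mul_one_div_cancel, ENNReal.rpow_one]
          positivity
      _ ≤ _ := ENNReal.rpow_le_rpow h1 (by positivity)
  have hfin : spectralRadius ℂ a ≠ ⊤ :=
    ne_top_of_le_ne_top ENNReal.coe_ne_top (spectrum.spectralRadius_le_nnnorm a)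
  exact (ENNReal.ofReal_le_iff_le_toReal hfin).1 hle

end SpectralRadius

/-! ### Generalized eigenvalues and domination by a nonnegative matrix -/

section Rayleigh

variable {ι : Type} [Fintype ι]

lemma continuous_dotProduct_mulVec_self (M : Matrix ι ι ℝ) :
    Continuous fun x : ι → ℝ => x ⬝ᵥ (M *ᵥ x) := by
  simp only [dotProduct, Matrix.mulVec]
  fun_prop

lemma smul_dotProduct_mulVec_smul (M : Matrix ι ι ℝ) (c : ℝ) (x : ι → ℝ) :
    (c • x) ⬝ᵥ (M *ᵥ (c • x)) = c ^ 2 * (x ⬝ᵥ (M *ᵥ x)) := by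
  rw [Matrix.mulVec_smul, smul_dotProduct, dotProduct_smul, smul_eq_mul, smul_eq_mul]
  ring

/-- The largest generalized eigenvalue of a symmetric matrix with respect to a positive definite
one. -/
lemma exists_generalized_eigenvector [Nonempty ι] {S N : Matrix ι ι ℝ} (hS : Sᵀ = S)
    (hN : N.PosDef) : ∃ (l : ℝ) (y : ι → ℝ), y ≠ 0 ∧ S *ᵥ y = l • (N *ᵥ y) ∧
      ∀ x, x ⬝ᵥ (S *ᵥ x) ≤ l * (x ⬝ᵥ (N *ᵥ x)) := by
  have hpos : ∀ x : ι → ℝ, x ≠ 0 → 0 < x ⬝ᵥ (N *ᵥ x) := fun x hx => by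
    simpa using hN.dotProduct_mulVec_pos hx
  obtain ⟨y, hy, hmax⟩ := (isCompact_sphere (0 : ι → ℝ) 1).exists_isMaxOn
    (NormedSpace.sphere_nonempty.2 zero_le_one)
    (f := fun x => (x ⬝ᵥ (S *ᵥ x)) / (x ⬝ᵥ (N *ᵥ x))) (by
      refine (continuous_dotProduct_mulVec_self S).continuousOn.div
        (continuous_dotProduct_mulVec_self N).continuousOn fun x hx => (hpos x ?_).ne'
      rintro rfl
      simp at hx)
  have hy0 : y ≠ 0 := by
    rintro rfl
    simp at hy
  set l := (y ⬝ᵥ (S *ᵥ y)) / (y ⬝ᵥ (N *ᵥ y)) with hl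
  have hle : ∀ x, x ⬝ᵥ (S *ᵥ x) ≤ l * (x ⬝ᵥ (N *ᵥ x)) := by
    intro x
    by_cases hx : x = 0
    · simp [hx]
    have hx' : 0 < ‖x‖ := norm_pos_iff.2 hx
    have h1 := hmax (a := ‖x‖⁻¹ • x) (by simp [norm_smul, hx'.ne'])
    simp only [mem_ofPred_eq, smul_dotProduct_mulVec_smul] at h1
    rwa [mul_div_mul_left _ _ (by positivity), ← hl, div_le_iff₀ (hpos x hx)] at h1
  -- A maximizer of the quotient is a zero of the semidefinite form of lN - S, hence lies in its
  -- kernel; no differentiation is needed.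
  have hPSD : (l • N - S).PosSemidef := by
    refine Matrix.PosSemidef.of_dotProduct_mulVec_nonneg ?_ fun x => ?_
    · have h1 := hN.isHermitian
      rw [Matrix.IsHermitian, Matrix.conjTranspose_eq_transpose_of_trivial] at h1 ⊢
      rw [Matrix.transpose_sub, Matrix.transpose_smul, h1, hS]
    · rw [star_trivial, Matrix.sub_mulVec, dotProduct_sub, Matrix.smul_mulVec, dotProduct_smul,
        smul_eq_mul, sub_nonneg]
      exact hle x
  refine ⟨l, y, hy0, ?_, hle⟩
  have h0 := (hPSD.dotProduct_mulVec_zero_iff y).1 (by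
    rw [star_trivial, Matrix.sub_mulVec, dotProduct_sub, Matrix.smul_mulVec, dotProduct_smul,
        smul_eq_mul, sub_eq_zero, hl, div_mul_cancel₀ _ (hpos y hy0).ne'])
  rw [Matrix.sub_mulVec, sub_eq_zero, Matrix.smul_mulVec] at h0
  exact h0.symm

/-- Let l be the top generalized eigenvalue, with eigenvector y. From ly = N⁻¹Sy one gets l|y| ≤
δ|N⁻¹|T|y| entrywise, and the Collatz–Wielandt bound applied to |y| gives l ≤ δρ(|N⁻¹|T). If l ≤ 0
there is nothing to prove. -/
lemma quadratic_le_specRad_mul [DecidableEq ι] {S N T : Matrix ι ι ℝ} (hS : Sᵀ = S) (hN : N.PosDef) {δ : ℝ}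
    (hδ : 0 ≤ δ) (hT : ∀ i j, 0 ≤ T i j) (hST : ∀ i j, |S i j| ≤ δ * T i j) (x : ι → ℝ) :
    x ⬝ᵥ (S *ᵥ x) ≤ δ * specRad ((N⁻¹).map (fun a : ℝ => |a|) * T) * (x ⬝ᵥ (N *ᵥ x)) := by
  cases isEmpty_or_nonempty ι
  · simp [dotProduct]
  have hNx : 0 ≤ x ⬝ᵥ (N *ᵥ x) := by
    simpa using hN.posSemidef.dotProduct_mulVec_nonneg x
  obtain ⟨l, y, hy0, hy, hle⟩ := exists_generalized_eigenvector hS hN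
  refine (hle x).trans (mul_le_mul_of_nonneg_right ?_ hNx)
  set A := (N⁻¹).map (fun a : ℝ => |a|) * T with hA
  rcases le_or_gt l 0 with hl | hl
  · exact hl.trans (mul_nonneg hδ (specRad_nonneg _))
  have hly : l • y = N⁻¹ *ᵥ (S *ᵥ y) := by
    rw [hy, Matrix.mulVec_smul, Matrix.mulVec_mulVec, Matrix.nonsing_inv_mul _
      ((Matrix.isUnit_iff_isUnit_det _).1 hN.isUnit), Matrix.one_mulVec]
  have habs : ∀ (M : Matrix ι ι ℝ) (v : ι → ℝ) (i : ι),
      |(M *ᵥ v) i| ≤ ∑ j, |M i j| * |v j| := fun M v i => by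
    simp only [Matrix.mulVec, dotProduct, ← abs_mul]
    exact Finset.abs_sum_le_sum_abs _ _
  have key : ∀ i, l * |y i| ≤ δ * (A *ᵥ fun j => |y j|) i := by
    intro i
    have h1 : l * |y i| = |(N⁻¹ *ᵥ (S *ᵥ y)) i| := by
      rw [← hly, Pi.smul_apply, smul_eq_mul, abs_mul, abs_of_pos hl]
    rw [h1, hA, ← Matrix.mulVec_mulVec]
    refine (habs _ _ i).trans ?_
    rw [Matrix.mulVec, dotProduct, Finset.mul_sum]
    refine Finset.sum_le_sum fun j _ => ?_
    rw [Matrix.map_apply, mul_left_comm]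
    refine mul_le_mul_of_nonneg_left ((habs _ _ j).trans ?_) (abs_nonneg _)
    rw [Matrix.mulVec, dotProduct, Finset.mul_sum]
    refine Finset.sum_le_sum fun k _ => ?_
    rw [← mul_assoc]
    exact mul_le_mul_of_nonneg_right (hST j k) (abs_nonneg _)
  obtain ⟨i₀, hi₀⟩ := Function.ne_iff.1 hy0
  have hδ' : 0 < δ := by
    refine hδ.lt_of_ne fun h => ?_
    have h2 := key i₀
    rw [← h, zero_mul] at h2
    exact absurd h2 (not_le.2 (mul_pos hl (abs_pos.2 hi₀)))
  rw [mul_comm, ← div_le_iff₀ hδ']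
  refine le_specRad (z := fun j => |y j|) (fun i j => ?_) (fun i => abs_nonneg _) ?_
    (by positivity) fun i => ?_
  · rw [hA, Matrix.mul_apply]
    exact Finset.sum_nonneg fun k _ => mul_nonneg (abs_nonneg _) (hT k j)
  · exact fun h => hi₀ (abs_eq_zero.1 (congrFun h i₀))
  · rw [div_mul_eq_mul_div, div_le_iff₀ hδ', mul_comm _ δ]
    exact key i

end Rayleigh

/-! ### The bound on the perturbation -/

lemma Rtilde_apply (p q : Idx n) : Rtilde n p q = if IsSuperdiag n p q then 1 else 0 := rfl

lemma Rtilde_nonneg (p q : Idx n) : 0 ≤ Rtilde n p q := by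
  rw [Rtilde_apply]
  split_ifs <;> simp

lemma abs_le_mul_Rtilde {δ : ℝ} {R : Matrix (Idx n) (Idx n) ℝ}
    (hR0 : ∀ p q, ¬ IsSuperdiag n p q → R p q = 0) (hR : ∀ p q, IsSuperdiag n p q → |R p q| ≤ δ)
    (p q : Idx n) : |R p q| ≤ δ * Rtilde n p q := by
  rw [Rtilde_apply]
  split_ifs with h
  · simpa using hR p q h
  · simp [hR0 p q h]

lemma perturbation_quadratic_le {γ δ : ℝ} (hγ : γ ≤ 1) (hδ : δ = (1 - γ) / specRad (Gtilde n))
    {R : Matrix (Idx n) (Idx n) ℝ}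
    (hR0 : ∀ p q, ¬ IsSuperdiag n p q → R p q = 0) (hR : ∀ p q, IsSuperdiag n p q → |R p q| ≤ δ)
    (x : Idx n → ℝ) :
    x ⬝ᵥ ((F n * R + Rᵀ * F n) *ᵥ x) ≤ (1 - γ) * (x ⬝ᵥ (F1 n *ᵥ x)) := by
  have hδ0 : 0 ≤ δ := hδ ▸ div_nonneg (by linarith) (specRad_nonneg _)
  have hb := abs_le_mul_Rtilde hR0 hR
  have h := quadratic_le_specRad_mul (S := F n * R + Rᵀ * F n) (N := F1 n)
    (T := F n * Rtilde n + (Rtilde n)ᵀ * F n) (by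
      rw [Matrix.transpose_add, Matrix.transpose_mul, Matrix.transpose_mul, F_transpose,
        Matrix.transpose_transpose, add_comm]) F1_posDef hδ0 (fun i j => by
      rw [Matrix.add_apply, Matrix.mul_apply, Matrix.mul_apply]
      exact add_nonneg
        (Finset.sum_nonneg fun k _ => mul_nonneg (F_nonneg _ _) (Rtilde_nonneg _ _))
        (Finset.sum_nonneg fun k _ => mul_nonneg (Rtilde_nonneg _ _) (F_nonneg _ _)))
    (fun i j => by
      rw [Matrix.add_apply, Matrix.add_apply, mul_add]
      refine (abs_add_le _ _).trans (add_le_add ?_ ?_)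
      · rw [Matrix.mul_apply, Matrix.mul_apply, Finset.mul_sum]
        refine (Finset.abs_sum_le_sum_abs _ _).trans (Finset.sum_le_sum fun k _ => ?_)
        rw [abs_mul, abs_of_nonneg (F_nonneg _ _), mul_left_comm]
        exact mul_le_mul_of_nonneg_left (hb k j) (F_nonneg _ _)
      · rw [Matrix.mul_apply, Matrix.mul_apply, Finset.mul_sum]
        refine (Finset.abs_sum_le_sum_abs _ _).trans (Finset.sum_le_sum fun k _ => ?_)
        rw [abs_mul, abs_of_nonneg (F_nonneg _ _), ← mul_assoc]
        exact mul_le_mul_of_nonneg_right (hb k i) (F_nonneg _ _)) x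
  refine h.trans (mul_le_mul_of_nonneg_right ?_ ?_)
  · change δ * specRad (Gtilde n) ≤ 1 - γ
    rw [hδ]
    -- If ρ(G̃) = 0 then division by zero makes δ = 0, and the bound reduces to γ ≤ 1.
    rcases (specRad_nonneg (Gtilde n)).eq_or_lt with h0 | h0
    · rw [← h0]
      linarith
    · rw [div_mul_cancel₀ _ h0.ne']
  · simpa using F1_posDef.posSemidef.dotProduct_mulVec_nonneg x

/-! ### Matrices and quadratic forms on Euclidean vectors -/

section Act

variable {ι κ : Type} [Fintype κ]

lemma act_apply (M : Matrix ι κ ℝ) (x : EuclideanSpace ℝ κ) (i : ι) :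
    act M x i = ∑ j, M i j * x j := rfl

lemma ofLp_act (M : Matrix ι κ ℝ) (x : EuclideanSpace ℝ κ) :
    (act M x).ofLp = M *ᵥ x.ofLp := rfl

lemma act_add (M : Matrix ι κ ℝ) (x y : EuclideanSpace ℝ κ) :
    act M (x + y) = act M x + act M y := by
  ext i
  simp [ofLp_act, Matrix.mulVec_add]

lemma act_sub (M : Matrix ι κ ℝ) (x y : EuclideanSpace ℝ κ) :
    act M (x - y) = act M x - act M y := by
  ext i
  simp [ofLp_act, Matrix.mulVec_sub]

lemma act_smul (M : Matrix ι κ ℝ) (c : ℝ) (x : EuclideanSpace ℝ κ) :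
    act M (c • x) = c • act M x := by
  ext i
  simp [ofLp_act, Matrix.mulVec_smul]

lemma add_act (M N : Matrix ι κ ℝ) (x : EuclideanSpace ℝ κ) :
    act (M + N) x = act M x + act N x := by
  ext i
  simp [ofLp_act, Matrix.add_mulVec]

lemma smul_act (c : ℝ) (M : Matrix ι κ ℝ) (x : EuclideanSpace ℝ κ) :
    act (c • M) x = c • act M x := by
  ext i
  simp [ofLp_act, Matrix.smul_mulVec]

lemma act_act {μ : Type} [Fintype μ] (M : Matrix ι κ ℝ) (N : Matrix κ μ ℝ)
    (x : EuclideanSpace ℝ μ) : act M (act N x) = act (M * N) x := by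
  ext i
  simp [ofLp_act]

lemma act_zero (M : Matrix ι κ ℝ) : act M 0 = 0 := by
  ext i
  simp [ofLp_act]

end Act

section Euclidean

variable {ι κ : Type} [Fintype ι] [Fintype κ]

lemma norm_sq_eq_dotProduct (x : EuclideanSpace ℝ ι) : ‖x‖ ^ 2 = x.ofLp ⬝ᵥ x.ofLp := by
  rw [EuclideanSpace.norm_sq_eq]
  simp [dotProduct, sq]

lemma opNorm_nonneg [DecidableEq κ] (M : Matrix ι κ ℝ) : 0 ≤ opNorm M := norm_nonneg _

lemma norm_act_le [DecidableEq κ] (M : Matrix ι κ ℝ) (x : EuclideanSpace ℝ κ) :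
    ‖act M x‖ ≤ opNorm M * ‖x‖ :=
  (LinearMap.toContinuousLinearMap (Matrix.toEuclideanLin M)).le_opNorm x

lemma quadForm_zero (M : Matrix ι ι ℝ) : quadForm M 0 = 0 := by
  simp [quadForm]

lemma continuous_quadForm (M : Matrix ι ι ℝ) : Continuous (quadForm M) := by
  unfold quadForm
  simp only [dotProduct, Matrix.mulVec]
  fun_prop

lemma quadForm_le (M : Matrix ι ι ℝ) [DecidableEq ι] (x : EuclideanSpace ℝ ι) :
    quadForm M x ≤ opNorm M * ‖x‖ ^ 2 := by
  have h : quadForm M x = inner ℝ (act M x) x := by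
    rw [EuclideanSpace.inner_eq_star_dotProduct, ofLp_act, quadForm, star_trivial, dotProduct_comm]
  rw [h]
  refine (real_inner_le_norm _ _).trans ?_
  rw [sq, ← mul_assoc]
  exact mul_le_mul_of_nonneg_right (norm_act_le M x) (norm_nonneg _)

lemma quadForm_sub_smul {M : Matrix ι ι ℝ} (hM : Mᵀ = M) (c : ℝ) (x y : EuclideanSpace ℝ ι) :
    quadForm M (x - c • y)
      = quadForm M x - 2 * c * ((act M x).ofLp ⬝ᵥ y.ofLp) + c ^ 2 * quadForm M y := by
  have h : (M *ᵥ y.ofLp) ⬝ᵥ x.ofLp = (M *ᵥ x.ofLp) ⬝ᵥ y.ofLp := by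
    rw [dotProduct_comm, Matrix.dotProduct_mulVec, ← Matrix.mulVec_transpose, hM]
  simp only [quadForm, ofLp_act, WithLp.ofLp_smul, WithLp.ofLp_sub, Matrix.mulVec_sub,
    Matrix.mulVec_smul, sub_dotProduct, dotProduct_sub, smul_dotProduct, dotProduct_smul,
    smul_eq_mul, h]
  ring

lemma posDef_quadForm_pos {M : Matrix ι ι ℝ} (hM : M.PosDef) {x : EuclideanSpace ℝ ι}
    (hx : x ≠ 0) : 0 < quadForm M x := by
  have h := hM.dotProduct_mulVec_pos (x := x.ofLp) (by simpa using hx)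
  rwa [star_trivial, dotProduct_comm] at h

lemma posDef_quadForm_nonneg {M : Matrix ι ι ℝ} (hM : M.PosDef) (x : EuclideanSpace ℝ ι) :
    0 ≤ quadForm M x := by
  rcases eq_or_ne x 0 with rfl | hx
  · rw [quadForm_zero]
  · exact (posDef_quadForm_pos hM hx).le

/-- Evaluating the nonnegative form at w - L⁻¹Mw, with L the norm of M, gives the bound without a
square root of M. -/
lemma norm_act_sq_le [DecidableEq ι] {M : Matrix ι ι ℝ} (hM : M.PosDef)
    (w : EuclideanSpace ℝ ι) : ‖act M w‖ ^ 2 ≤ opNorm M * quadForm M w := by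
  have hMt : Mᵀ = M := by
    have h := hM.isHermitian
    rwa [Matrix.IsHermitian, Matrix.conjTranspose_eq_transpose_of_trivial] at h
  set y := act M w with hy
  set L := opNorm M with hL
  have hL0 : 0 ≤ L := opNorm_nonneg M
  rcases hL0.eq_or_lt with h0 | h0
  · have h1 : ‖y‖ ≤ 0 := by
      have := norm_act_le M w
      rwa [← hL, ← h0, zero_mul] at this
    rw [le_antisymm h1 (norm_nonneg _), ← h0]
    simp
  · have h1 := posDef_quadForm_nonneg hM (w - L⁻¹ • y)
    rw [quadForm_sub_smul hMt, ← hy, ← norm_sq_eq_dotProduct] at h1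
    have h2 : L⁻¹ ^ 2 * quadForm M y ≤ L⁻¹ ^ 2 * (L * ‖y‖ ^ 2) := by
      gcongr
      exact quadForm_le M y
    have h3 : L⁻¹ ^ 2 * (L * ‖y‖ ^ 2) = L⁻¹ * ‖y‖ ^ 2 := by
      field_simp
    have h4 : L⁻¹ * ‖y‖ ^ 2 ≤ quadForm M w := by linarith
    rwa [inv_mul_le_iff₀ h0] at h4

lemma convex_quadForm_le {M : Matrix ι ι ℝ} (hM : M.PosDef) (b : ℝ) :
    Convex ℝ {x : EuclideanSpace ℝ ι | quadForm M x ≤ b} := by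
  intro x hx y hy s t hs ht hst
  have h := posDef_quadForm_nonneg hM (x - y)
  have h1 : quadForm M (s • x + t • y)
      = s * quadForm M x + t * quadForm M y - s * t * quadForm M (x - y) := by
    obtain rfl : t = 1 - s := by linarith
    simp only [quadForm, WithLp.ofLp_smul, WithLp.ofLp_sub, WithLp.ofLp_add, Matrix.mulVec_sub,
      Matrix.mulVec_add, Matrix.mulVec_smul, sub_dotProduct, dotProduct_sub, add_dotProduct,
      dotProduct_add, smul_dotProduct, dotProduct_smul, smul_eq_mul]
    ring
  change quadForm M (s • x + t • y) ≤ b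
  rw [h1]
  have h2 : s * quadForm M x ≤ s * b := mul_le_mul_of_nonneg_left hx hs
  have h3 : t * quadForm M y ≤ t * b := mul_le_mul_of_nonneg_left hy ht
  have h4 := mul_nonneg (mul_nonneg hs ht) h
  have h5 : s * b + t * b = b := by rw [← add_mul, hst, one_mul]
  linarith

end Euclidean

/-! ### The scaling D(θ) and the equation that defines Θ -/

lemma norm_sq_le_quadForm_F (y : State n) : ‖y‖ ^ 2 ≤ opNorm (Finv n) * quadForm (F n) y := by
  have h := norm_act_sq_le Finv_posDef (act (F n) y)
  have h1 : act (Finv n) (act (F n) y) = y := by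
    rw [act_act, Finv_mul_F]
    ext i
    simp [ofLp_act]
  rw [h1] at h
  refine h.trans (le_of_eq ?_)
  congr 1
  rw [quadForm, ← ofLp_act, h1, quadForm, dotProduct_comm]
  rfl

lemma act_D_apply (θ : ℝ) (x : State n) (p : Idx n) :
    act (D n θ) x p = θ ^ (-expo n p) * x p := by
  simp [ofLp_act, D, Matrix.mulVec_diagonal]

lemma quadForm_DFD (θ : ℝ) (x : State n) :
    quadForm (D n θ * F n * D n θ) x = quadForm (F n) (act (D n θ) x) := by
  simp only [quadForm, ofLp_act]
  have h : (D n θ)ᵀ = D n θ := Matrix.diagonal_transpose _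
  rw [← Matrix.mulVec_mulVec, ← Matrix.mulVec_mulVec, dotProduct_comm, Matrix.dotProduct_mulVec,
    ← Matrix.mulVec_transpose, h, dotProduct_comm]

lemma act_D_ne_zero {θ : ℝ} (hθ : 0 < θ) {x : State n} (hx : x ≠ 0) : act (D n θ) x ≠ 0 := by
  intro h
  apply hx
  ext p
  have h1 := congrArg (fun v : State n => v p) h
  simp only [act_D_apply, PiLp.zero_apply] at h1
  exact (mul_eq_zero.1 h1).resolve_left (Real.rpow_pos_of_pos hθ _).ne'

lemma DFD_posDef {θ : ℝ} (hθ : 0 < θ) : (D n θ * F n * D n θ).PosDef := by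
  have h : (D n θ)ᵀ = D n θ := Matrix.diagonal_transpose _
  refine Matrix.PosDef.of_dotProduct_mulVec_pos ?_ fun x hx => ?_
  · rw [Matrix.IsHermitian, Matrix.conjTranspose_eq_transpose_of_trivial, Matrix.transpose_mul,
      Matrix.transpose_mul, h, F_transpose, Matrix.mul_assoc]
  · rw [star_trivial, dotProduct_comm]
    change 0 < quadForm (D n θ * F n * D n θ) (WithLp.toLp 2 x)
    rw [quadForm_DFD]
    exact posDef_quadForm_pos F_posDef (act_D_ne_zero hθ (by simpa using hx))

lemma hasDerivAt_act_D {θ : ℝ} (hθ : 0 < θ) (x : State n) (p : Idx n) :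
    HasDerivAt (fun s => act (D n s) x p) (θ⁻¹ * (-expo n p * act (D n θ) x p)) θ := by
  simp only [act_D_apply]
  have h := (Real.hasDerivAt_rpow_const (x := θ) (p := -expo n p) (Or.inl hθ.ne')).mul_const (x p)
  refine h.congr_deriv ?_
  rw [Real.rpow_sub_one hθ.ne']
  field_simp

lemma H_mulVec (y : Idx n → ℝ) (p : Idx n) : (H n *ᵥ y) p = -expo n p * y p := by
  simp [H, Matrix.mulVec_diagonal]

lemma quadForm_F1 (y : State n) : quadForm (F1 n) y =
    quadForm (F n) y - 2 * ((F n *ᵥ y.ofLp) ⬝ᵥ (H n *ᵥ y.ofLp)) := by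
  have hH : (H n)ᵀ = H n := Matrix.diagonal_transpose _
  have h1 : ((F n * H n) *ᵥ y.ofLp) ⬝ᵥ y.ofLp = (F n *ᵥ y.ofLp) ⬝ᵥ (H n *ᵥ y.ofLp) := by
    rw [← Matrix.mulVec_mulVec, dotProduct_comm, Matrix.dotProduct_mulVec,
      ← Matrix.mulVec_transpose, F_transpose]
  have h2 : ((H n * F n) *ᵥ y.ofLp) ⬝ᵥ y.ofLp = (F n *ᵥ y.ofLp) ⬝ᵥ (H n *ᵥ y.ofLp) := by
    rw [← Matrix.mulVec_mulVec, dotProduct_comm, Matrix.dotProduct_mulVec,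
      ← Matrix.mulVec_transpose, hH, dotProduct_comm]
  rw [quadForm, F1, Matrix.sub_mulVec, Matrix.sub_mulVec, sub_dotProduct, sub_dotProduct, h1, h2,
    quadForm]
  ring

/-- The chain rule for `quadForm M` along a curve given by its coordinates. -/
lemma hasDerivWithinAt_quadForm {ι : Type} [Fintype ι] {M : Matrix ι ι ℝ} (hM : Mᵀ = M)
    {y : ℝ → EuclideanSpace ℝ ι} {y' : ι → ℝ} {s : Set ℝ} {t : ℝ}
    (h : ∀ i, HasDerivWithinAt (fun u => y u i) (y' i) s t) :
    HasDerivWithinAt (fun u => quadForm M (y u)) (2 * ((M *ᵥ (y t).ofLp) ⬝ᵥ y')) s t := by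
  have h1 : ∀ i, HasDerivWithinAt (fun u => (M *ᵥ (y u).ofLp) i) ((M *ᵥ y') i) s t := by
    intro i
    simp only [Matrix.mulVec, dotProduct]
    exact HasDerivWithinAt.fun_sum fun j _ => (h j).const_mul _
  have h2 : HasDerivWithinAt (fun u => ∑ i, (M *ᵥ (y u).ofLp) i * y u i)
      (∑ i, ((M *ᵥ y') i * y t i + (M *ᵥ (y t).ofLp) i * y' i)) s t :=
    HasDerivWithinAt.fun_sum fun i _ => (h1 i).mul (h i)
  refine h2.congr_deriv ?_
  rw [Finset.sum_add_distrib]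
  change (M *ᵥ y') ⬝ᵥ (y t).ofLp + (M *ᵥ (y t).ofLp) ⬝ᵥ y' = _
  rw [dotProduct_comm, Matrix.dotProduct_mulVec, ← Matrix.mulVec_transpose, hM]
  ring

/-- From θ·D′(θ) = HD(θ), the derivative is θ⁻¹ times the form of FH + HF = F - F¹ at D(θ)x.
Dividing the function by θ then removes F and leaves only -F¹, which is where F¹ enters and why the
root is unique. -/
lemma hasDerivAt_quadForm_DFD {θ : ℝ} (hθ : 0 < θ) (x : State n) :
    HasDerivAt (fun s => quadForm (D n s * F n * D n s) x)
      (θ⁻¹ * (quadForm (F n) (act (D n θ) x) - quadForm (F1 n) (act (D n θ) x))) θ := by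
  simp only [quadForm_DFD]
  rw [← hasDerivWithinAt_univ]
  have h := hasDerivWithinAt_quadForm F_transpose (y := fun s => act (D n s) x)
    (fun p => (hasDerivAt_act_D hθ x p).hasDerivWithinAt (s := univ))
  refine h.congr_deriv ?_
  rw [quadForm_F1]
  have h2 : (fun p => θ⁻¹ * (-expo n p * act (D n θ) x p)) =
      θ⁻¹ • (H n *ᵥ (act (D n θ) x).ofLp) := by
    ext p
    rw [Pi.smul_apply, H_mulVec, smul_eq_mul]
  rw [h2, dotProduct_smul, smul_eq_mul]
  ring

lemma hasDerivAt_quadForm_DFD_div {θ : ℝ} (hθ : 0 < θ) (x : State n) :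
    HasDerivAt (fun s => quadForm (D n s * F n * D n s) x / s)
      (-quadForm (F1 n) (act (D n θ) x) / θ ^ 2) θ := by
  refine ((hasDerivAt_quadForm_DFD hθ x).div (hasDerivAt_id θ) hθ.ne').congr_deriv ?_
  rw [quadForm_DFD]
  simp only [id]
  field_simp
  ring

lemma strictAntiOn_quadForm_DFD_div {x : State n} (hx : x ≠ 0) :
    StrictAntiOn (fun s => quadForm (D n s * F n * D n s) x / s) (Ioi 0) := by
  refine strictAntiOn_of_deriv_neg (convex_Ioi 0) (fun θ hθ =>
    (hasDerivAt_quadForm_DFD_div hθ x).continuousAt.continuousWithinAt) fun θ hθ => ?_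
  rw [interior_Ioi] at hθ
  rw [(hasDerivAt_quadForm_DFD_div hθ x).deriv]
  have h := posDef_quadForm_pos F1_posDef (act_D_ne_zero hθ hx)
  have h2 : 0 < θ ^ 2 := by
    have : 0 < θ := hθ
    positivity
  exact div_neg_of_neg_of_pos (neg_neg_of_pos h) h2

lemma half_le_expo (p : Idx n) : 1 / 2 ≤ expo n p := by
  rw [expo_eq]
  have : (0 : ℝ) ≤ codist n p := by positivity
  linarith

lemma norm_sq_le_of_le_one {θ : ℝ} (hθ : 0 < θ) (hθ1 : θ ≤ 1) (x : State n) :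
    ‖x‖ ^ 2 ≤ θ * ‖act (D n θ) x‖ ^ 2 := by
  rw [EuclideanSpace.norm_sq_eq, EuclideanSpace.norm_sq_eq, Finset.mul_sum]
  refine Finset.sum_le_sum fun p _ => ?_
  rw [act_D_apply, norm_mul, mul_pow, ← mul_assoc]
  refine le_mul_of_one_le_left (by positivity) ?_
  rw [Real.norm_of_nonneg (by positivity), ← Real.rpow_natCast, ← Real.rpow_mul hθ.le]
  nth_rw 1 [← Real.rpow_one θ]
  rw [← Real.rpow_add hθ]
  refine Real.one_le_rpow_of_pos_of_le_one_of_nonpos hθ hθ1 ?_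
  have := half_le_expo p
  push_cast
  linarith

lemma norm_sq_le_of_one_le {θ : ℝ} (hθ1 : 1 ≤ θ) (x : State n) :
    ‖act (D n θ) x‖ ^ 2 ≤ ‖x‖ ^ 2 := by
  have hθ : 0 < θ := by linarith
  rw [EuclideanSpace.norm_sq_eq, EuclideanSpace.norm_sq_eq]
  refine Finset.sum_le_sum fun p _ => ?_
  rw [act_D_apply, norm_mul, mul_pow]
  refine mul_le_of_le_one_left (by positivity) ?_
  rw [Real.norm_of_nonneg (by positivity)]
  refine pow_le_one₀ (by positivity) (Real.rpow_le_one_of_one_le_of_nonpos hθ1 ?_)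
  have := half_le_expo p
  linarith

lemma exists_isRoot {a₀ : ℝ} (ha0 : 0 < a₀) {x : State n} (hx : x ≠ 0) :
    ∃ θ, IsRoot n a₀ x θ := by
  set C := opNorm (Finv n) + 1 with hC
  have hC0 : 0 < C := by
    have := opNorm_nonneg (Finv n)
    positivity
  set C' := opNorm (F n) with hC'
  have hC'0 : 0 ≤ C' := opNorm_nonneg _
  have hx2 : 0 < ‖x‖ ^ 2 := by
    have := norm_pos_iff.2 hx
    positivity
  -- All exponents are at least 1/2, so ‖x‖² ≤ θ‖D(θ)x‖² for θ ≤ 1 and ‖D(θ)x‖ ≤ ‖x‖ for θ ≥ 1. The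
  -- two thresholds are where these estimates put the quotient above, respectively below, 2a₀.
  set θ₁ := min 1 (‖x‖ ^ 2 / (C * (2 * a₀))) with hθ₁
  set θ₂ := max 1 (C' * ‖x‖ ^ 2 / (2 * a₀)) with hθ₂
  have h1 : 0 < θ₁ := lt_min one_pos (by positivity)
  have h1' : θ₁ ≤ 1 := min_le_left _ _
  have h2 : 1 ≤ θ₂ := le_max_left _ _
  have hlow : 2 * a₀ ≤ quadForm (D n θ₁ * F n * D n θ₁) x / θ₁ := by
    rw [quadForm_DFD, le_div_iff₀ h1]
    have h3 := norm_sq_le_quadForm_F (act (D n θ₁) x)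
    have h4 := norm_sq_le_of_le_one h1 h1' x
    have h5 : 0 ≤ quadForm (F n) (act (D n θ₁) x) := posDef_quadForm_nonneg F_posDef _
    have h6 : θ₁ * (C * (2 * a₀)) ≤ ‖x‖ ^ 2 := by
      rw [← le_div_iff₀ (by positivity)]
      exact min_le_right _ _
    have h7 : ‖act (D n θ₁) x‖ ^ 2 ≤ C * quadForm (F n) (act (D n θ₁) x) := by
      rw [hC, add_mul]
      linarith
    have h8 : θ₁ * ‖act (D n θ₁) x‖ ^ 2 ≤ ‖act (D n θ₁) x‖ ^ 2 :=
      mul_le_of_le_one_left (by positivity) h1'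
    have h9 : C * (2 * a₀ * θ₁) ≤ C * quadForm (F n) (act (D n θ₁) x) := by linarith
    exact le_of_mul_le_mul_left h9 hC0
  have hupp : quadForm (D n θ₂ * F n * D n θ₂) x / θ₂ ≤ 2 * a₀ := by
    have h0 : 0 < θ₂ := by linarith
    rw [quadForm_DFD, div_le_iff₀ h0]
    have h3 := (quadForm_le (F n) (act (D n θ₂) x)).trans
      (mul_le_mul_of_nonneg_left (norm_sq_le_of_one_le h2 x) hC'0)
    have h6 : C' * ‖x‖ ^ 2 ≤ θ₂ * (2 * a₀) := by
      rw [← div_le_iff₀ (by positivity)]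
      exact le_max_right _ _
    linarith
  obtain ⟨θ, hθ, hroot⟩ := intermediate_value_Icc' (h1'.trans h2)
    (f := fun s => quadForm (D n s * F n * D n s) x / s)
    (fun s hs => (hasDerivAt_quadForm_DFD_div (h1.trans_le hs.1)
      x).continuousAt.continuousWithinAt) ⟨hupp, hlow⟩
  have hθ0 : 0 < θ := h1.trans_le hθ.1
  refine ⟨θ, hθ0, ?_⟩
  simp only at hroot
  rw [← hroot, div_mul_cancel₀ _ hθ0.ne']

lemma IsRoot.div_eq {a₀ : ℝ} {x : State n} {θ : ℝ} (h : IsRoot n a₀ x θ) :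
    quadForm (D n θ * F n * D n θ) x / θ = 2 * a₀ := by
  rw [← h.2, mul_div_cancel_right₀ _ h.1.ne']

lemma IsRoot.eq {a₀ : ℝ} {x : State n} (hx : x ≠ 0) {θ θ' : ℝ} (h : IsRoot n a₀ x θ)
    (h' : IsRoot n a₀ x θ') : θ = θ' :=
  (strictAntiOn_quadForm_DFD_div hx).injOn h.1 h'.1 (h.div_eq.trans h'.div_eq.symm)

/-! ### The controllability function and its sublevel sets -/

lemma Theta_zero (a₀ : ℝ) : Theta n a₀ 0 = 0 := by
  simp [Theta]

lemma isRoot_Theta {a₀ : ℝ} (ha0 : 0 < a₀) {x : State n} (hx : x ≠ 0) :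
    IsRoot n a₀ x (Theta n a₀ x) := by
  have h : x ≠ 0 ∧ ∃ θ, IsRoot n a₀ x θ := ⟨hx, exists_isRoot ha0 hx⟩
  rw [Theta, dif_pos h]
  exact h.2.choose_spec

lemma Theta_pos {a₀ : ℝ} (ha0 : 0 < a₀) {x : State n} (hx : x ≠ 0) : 0 < Theta n a₀ x :=
  (isRoot_Theta ha0 hx).1

lemma Theta_nonneg {a₀ : ℝ} (ha0 : 0 < a₀) (x : State n) : 0 ≤ Theta n a₀ x := by
  rcases eq_or_ne x 0 with rfl | hx
  · rw [Theta_zero]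
  · exact (Theta_pos ha0 hx).le

/-- Monotonicity of the quotient in θ turns every sublevel set of Θ into an ellipsoid; its convexity
and compactness are used to solve the differential equation. -/
lemma Theta_le_iff {a₀ : ℝ} (ha0 : 0 < a₀) (x : State n) {θ : ℝ} (hθ : 0 < θ) :
    Theta n a₀ x ≤ θ ↔ quadForm (D n θ * F n * D n θ) x ≤ 2 * a₀ * θ := by
  rcases eq_or_ne x 0 with rfl | hx
  · rw [Theta_zero, quadForm_zero]
    exact ⟨fun _ => by positivity, fun _ => hθ.le⟩
  · have h := isRoot_Theta ha0 hx
    rw [← (strictAntiOn_quadForm_DFD_div hx).le_iff_ge hθ h.1, h.div_eq, div_le_iff₀ hθ]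

lemma setOf_Theta_le {a₀ : ℝ} (ha0 : 0 < a₀) {θ : ℝ} (hθ : 0 < θ) :
    {x : State n | Theta n a₀ x ≤ θ} =
      {x | quadForm (D n θ * F n * D n θ) x ≤ 2 * a₀ * θ} :=
  Set.ext fun x => Theta_le_iff ha0 x hθ

lemma convex_Theta_le {a₀ : ℝ} (ha0 : 0 < a₀) {θ : ℝ} (hθ : 0 < θ) :
    Convex ℝ {x : State n | Theta n a₀ x ≤ θ} := by
  rw [setOf_Theta_le ha0 hθ]
  exact convex_quadForm_le (DFD_posDef hθ) _

lemma isClosed_Theta_le {a₀ : ℝ} (ha0 : 0 < a₀) {θ : ℝ} (hθ : 0 < θ) :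
    IsClosed {x : State n | Theta n a₀ x ≤ θ} := by
  rw [setOf_Theta_le ha0 hθ]
  exact isClosed_le (continuous_quadForm _) continuous_const

lemma Theta_le_mem_nhds {a₀ : ℝ} (ha0 : 0 < a₀) {θ : ℝ} (hθ : 0 < θ) :
    {x : State n | Theta n a₀ x ≤ θ} ∈ 𝓝 (0 : State n) := by
  rw [setOf_Theta_le ha0 hθ]
  have h : ∀ᶠ x in 𝓝 (0 : State n), quadForm (D n θ * F n * D n θ) x < 2 * a₀ * θ := by
    refine (continuous_quadForm _).continuousAt.eventually (gt_mem_nhds ?_)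
    rw [quadForm_zero]
    positivity
  exact h.mono fun x hx => le_of_lt hx

lemma norm_act_D_Theta_sq_le {a₀ : ℝ} (ha0 : 0 < a₀) {x : State n} (hx : x ≠ 0) :
    ‖act (D n (Theta n a₀ x)) x‖ ^ 2 ≤ opNorm (Finv n) * (2 * a₀ * Theta n a₀ x) := by
  have h := norm_sq_le_quadForm_F (act (D n (Theta n a₀ x)) x)
  rwa [← quadForm_DFD, ← (isRoot_Theta ha0 hx).2] at h

lemma norm_sq_le_of_Theta_le_one {a₀ : ℝ} (ha0 : 0 < a₀) {x : State n}
    (h : Theta n a₀ x ≤ 1) : ‖x‖ ^ 2 ≤ opNorm (Finv n) * (2 * a₀ * Theta n a₀ x) := by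
  rcases eq_or_ne x 0 with rfl | hx
  · simp [Theta_zero]
  refine (norm_sq_le_of_le_one (Theta_pos ha0 hx) h x).trans ?_
  refine (mul_le_of_le_one_left (by positivity) h).trans (norm_act_D_Theta_sq_le ha0 hx)

lemma isCompact_Theta_le {a₀ : ℝ} (ha0 : 0 < a₀) {θ : ℝ} (hθ : 0 < θ) :
    IsCompact {x : State n | Theta n a₀ x ≤ θ} := by
  refine Metric.isCompact_of_isClosed_isBounded (isClosed_Theta_le ha0 hθ) ?_
  rw [setOf_Theta_le ha0 hθ]
  obtain ⟨c, hc0, hc⟩ : ∃ c : ℝ, 0 < c ∧ ∀ x : State n, c * ‖x‖ ≤ ‖act (D n θ) x‖ := by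
    have hu : act (D n θ⁻¹) ∘ act (D n θ) = (id : State n → State n) := by
      ext x p
      simp only [Function.comp, act_D_apply, id]
      rw [Real.inv_rpow hθ.le, inv_mul_cancel_left₀ (Real.rpow_pos_of_pos hθ _).ne']
    refine ⟨(opNorm (D n θ⁻¹) + 1)⁻¹, inv_pos.2 (by linarith [opNorm_nonneg (D n θ⁻¹)]),
      fun x => ?_⟩
    rw [inv_mul_le_iff₀ (by linarith [opNorm_nonneg (D n θ⁻¹)])]
    have h := norm_act_le (D n θ⁻¹) (act (D n θ) x)
    have h1 := congrFun hu x
    simp only [Function.comp, id] at h1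
    rw [h1] at h
    linarith [norm_nonneg (act (D n θ) x)]
  refine (Metric.isBounded_closedBall (x := (0 : State n))
    (r := c⁻¹ * Real.sqrt (opNorm (Finv n) * (2 * a₀ * θ)))).subset fun x hx => ?_
  rw [mem_closedBall_zero_iff, ← div_eq_inv_mul, le_div_iff₀ hc0, mul_comm]
  refine (hc x).trans (Real.le_sqrt_of_sq_le ?_)
  refine (norm_sq_le_quadForm_F _).trans (mul_le_mul_of_nonneg_left ?_ (opNorm_nonneg _))
  rw [← quadForm_DFD]
  exact hx

/-! ### Smoothness and differential of Θ -/

lemma isInvertible_of_apply_one_ne_zero {L : ℝ →L[ℝ] ℝ} (h : L 1 ≠ 0) : L.IsInvertible := by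
  refine ⟨ContinuousLinearEquiv.unitsEquivAut ℝ (Units.mk0 _ h), ?_⟩
  ext
  simp

lemma contDiffAt_quadForm_DFD {θ : ℝ} (hθ : 0 < θ) (x : State n) :
    ContDiffAt ℝ 1 (fun z : State n × ℝ => quadForm (D n z.2 * F n * D n z.2) z.1) (x, θ) := by
  simp only [quadForm_DFD]
  simp only [quadForm, dotProduct, Matrix.mulVec, act_D_apply]
  have h : ∀ p : Idx n, ContDiffAt ℝ 1
      (fun z : State n × ℝ => z.2 ^ (-expo n p) * z.1 p) (x, θ) := fun p => by
    refine ContDiffAt.mul (ContDiffAt.rpow_const_of_ne contDiffAt_snd hθ.ne') ?_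
    fun_prop
  exact ContDiffAt.sum fun p _ => (ContDiffAt.sum fun q _ => contDiffAt_const.mul (h q)).mul (h p)

/-- Implicit function theorem: at the root, the θ-derivative of the equation is -θ⁻¹(F¹y, y) with y
= D(θ)x ≠ 0. Near x the implicit branch is positive, hence equals Θ by uniqueness of the root. -/
lemma contDiffAt_Theta {a₀ : ℝ} (ha0 : 0 < a₀) {x : State n} (hx : x ≠ 0) :
    ContDiffAt ℝ 1 (Theta n a₀) x := by
  set θ := Theta n a₀ x with hθdef
  have hr := isRoot_Theta ha0 hx
  have hθ : 0 < θ := hr.1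
  let g : State n × ℝ → ℝ := fun z => quadForm (D n z.2 * F n * D n z.2) z.1 - 2 * a₀ * z.2
  have hg : ContDiffAt ℝ 1 g (x, θ) :=
    (contDiffAt_quadForm_DFD hθ x).sub (contDiffAt_const.mul contDiffAt_snd)
  have h1 : HasFDerivAt (fun s : ℝ => g (x, s))
      (fderiv ℝ g (x, θ) ∘L .inr ℝ (State n) ℝ) θ :=
    (hg.differentiableAt one_ne_zero).hasFDerivAt.comp θ (hasFDerivAt_prodMk_right x θ)
  have h2 : HasDerivAt (fun s : ℝ => g (x, s))
      (θ⁻¹ * (quadForm (F n) (act (D n θ) x) - quadForm (F1 n) (act (D n θ) x)) - 2 * a₀ * 1) θ :=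
    (hasDerivAt_quadForm_DFD hθ x).sub ((hasDerivAt_id θ).const_mul (2 * a₀))
  have h3 : (fderiv ℝ g (x, θ) ∘L .inr ℝ (State n) ℝ) 1 ≠ 0 := by
    rw [h1.hasDerivAt.unique h2, ← quadForm_DFD, ← hr.2, ← hθdef]
    have h4 := posDef_quadForm_pos F1_posDef (act_D_ne_zero hθ hx)
    have h5 : θ⁻¹ * (2 * a₀ * θ - quadForm (F1 n) (act (D n θ) x)) - 2 * a₀ * 1
        = -(θ⁻¹ * quadForm (F1 n) (act (D n θ) x)) := by
      field_simp
      ring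
    rw [h5]
    exact neg_ne_zero.2 (mul_pos (inv_pos.2 hθ) h4).ne'
  have hinv := isInvertible_of_apply_one_ne_zero h3
  have hC := hg.contDiffAt_implicitFunction one_ne_zero hinv
  refine hC.congr_of_eventuallyEq ?_
  have hself : hg.implicitFunction one_ne_zero hinv x = θ :=
    hg.implicitFunction_apply_self one_ne_zero hinv
  have hpos : ∀ᶠ z in 𝓝 x, 0 < hg.implicitFunction one_ne_zero hinv z := by
    refine hC.continuousAt.eventually (lt_mem_nhds ?_)
    change 0 < hg.implicitFunction one_ne_zero hinv x
    rwa [hself]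
  have hev : ∀ᶠ z in 𝓝 x, g (z, hg.implicitFunction one_ne_zero hinv z) = g (x, θ) :=
    hg.eventually_apply_implicitFunction one_ne_zero hinv
  have hg0 : g (x, θ) = 0 := sub_eq_zero.2 hr.2.symm
  filter_upwards [hpos, hev, isOpen_ne.mem_nhds hx] with z hz1 hz2 hz3
  refine (isRoot_Theta ha0 hz3).eq hz3 ⟨hz1, ?_⟩
  rw [hg0] at hz2
  exact (sub_eq_zero.1 hz2).symm

/-- Obtained by differentiating 2a₀Θ = (Fy, y) along the line x + tv; the terms from the dependence
of D on Θ combine with 2a₀ into the form of F¹. -/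
lemma fderiv_Theta_apply {a₀ : ℝ} (ha0 : 0 < a₀) {x : State n} (hx : x ≠ 0) (v : State n) :
    fderiv ℝ (Theta n a₀) x v * quadForm (F1 n) (act (D n (Theta n a₀ x)) x) =
      2 * Theta n a₀ x * ((F n *ᵥ (act (D n (Theta n a₀ x)) x).ofLp) ⬝ᵥ
        (act (D n (Theta n a₀ x)) v).ofLp) := by
  set θ := Theta n a₀ x with hθdef
  have hr := isRoot_Theta ha0 hx
  have hθ : 0 < θ := hr.1
  set y := act (D n θ) x with hy
  have hline : HasDerivAt (fun t : ℝ => x + t • v) v 0 := by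
    simpa using ((hasDerivAt_id (0 : ℝ)).smul_const v).const_add x
  have hx0 : x + (0 : ℝ) • v = x := by simp
  have hΘ : HasDerivAt (fun t : ℝ => Theta n a₀ (x + t • v)) (fderiv ℝ (Theta n a₀) x v) 0 := by
    have h := ((contDiffAt_Theta ha0 hx).differentiableAt one_ne_zero).hasFDerivAt
    rw [← hx0] at h
    have := h.comp_hasDerivAt (0 : ℝ) hline
    rwa [hx0] at this
  set d := fderiv ℝ (Theta n a₀) x v with hd
  have hcoord : ∀ p, HasDerivAt (fun t : ℝ => act (D n (Theta n a₀ (x + t • v))) (x + t • v) p)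
      (d * θ⁻¹ * (-expo n p * y p) + act (D n θ) v p) 0 := by
    intro p
    simp only [act_D_apply]
    have h1 : HasDerivAt (fun t : ℝ => (x + t • v) p) (v p) 0 := by
      simpa using ((hasDerivAt_id (0 : ℝ)).mul_const (v p)).const_add (x p)
    have h2 := hΘ.rpow_const (p := -expo n p) (Or.inl (by rw [hx0]; exact hθ.ne'))
    refine (h2.mul h1).congr_deriv ?_
    rw [hx0, ← hθdef, Real.rpow_sub_one hθ.ne', hy, act_D_apply]
    field_simp
  have hq := hasDerivWithinAt_quadForm F_transpose fun p => (hcoord p).hasDerivWithinAt (s := univ)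
  rw [hasDerivWithinAt_univ, hx0, ← hθdef, ← hy] at hq
  have hne : ∀ᶠ t : ℝ in 𝓝 0, x + t • v ≠ 0 := by
    refine hline.continuousAt.eventually (isOpen_ne.mem_nhds ?_)
    change x + (0 : ℝ) • v ≠ 0
    rwa [hx0]
  have hq2 := hq.congr_of_eventuallyEq (f₁ := fun t : ℝ => 2 * a₀ * Theta n a₀ (x + t • v)) (by
    filter_upwards [hne] with t ht
    rw [(isRoot_Theta ha0 ht).2, quadForm_DFD])
  have heq := hq2.unique (hΘ.const_mul (2 * a₀))
  have hvec : (fun p => d * θ⁻¹ * (-expo n p * y p) + act (D n θ) v p)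
      = (d * θ⁻¹) • (H n *ᵥ y.ofLp) + (act (D n θ) v).ofLp := by
    ext p
    rw [Pi.add_apply, Pi.smul_apply, H_mulVec, smul_eq_mul]
  rw [hvec, dotProduct_add, dotProduct_smul, smul_eq_mul] at heq
  have hroot : 2 * a₀ * θ = quadForm (F n) y := by rw [hr.2, quadForm_DFD]
  rw [quadForm_F1, ← hroot]
  field_simp at heq
  linarith

/-! ### Decrease of Θ along the closed-loop field -/

lemma isSuperdiag_expo {p q : Idx n} (h : IsSuperdiag n p q) : expo n p = expo n q + 1 := by
  rw [isSuperdiag_iff] at h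
  rw [expo_eq, expo_eq, h.2]
  push_cast
  ring

lemma D_mul_of_superdiag {M : Matrix (Idx n) (Idx n) ℝ}
    (hM : ∀ p q, ¬ IsSuperdiag n p q → M p q = 0) {θ : ℝ} (hθ : 0 < θ) :
    D n θ * M = θ⁻¹ • (M * D n θ) := by
  ext p q
  rw [D, Matrix.diagonal_mul, Matrix.smul_apply, Matrix.mul_diagonal, smul_eq_mul]
  by_cases h : IsSuperdiag n p q
  · rw [isSuperdiag_expo h, neg_add, Real.rpow_add hθ, Real.rpow_neg_one]
    ring
  · rw [hM p q h]
    ring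

lemma D_mul_B0 (θ : ℝ) : D n θ * B0 n = θ ^ (-(1 / 2) : ℝ) • B0 n := by
  ext p i
  rw [D, Matrix.diagonal_mul, Matrix.smul_apply, smul_eq_mul, B0_apply]
  split_ifs with h
  · rw [expo_eq, h.2]
    simp
  · simp

lemma B0_transpose_mul_D (θ : ℝ) : (B0 n)ᵀ * D n θ = θ ^ (-(1 / 2) : ℝ) • (B0 n)ᵀ := by
  have h := congrArg Matrix.transpose (D_mul_B0 (n := n) θ)
  rwa [Matrix.transpose_mul, Matrix.transpose_smul, D, Matrix.diagonal_transpose] at h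

lemma B0_mul_transpose_mul_K (k : Matrix (Fin r) (Idx n) ℝ) : B0 n * ((B0 n)ᵀ * K n k) = K n k := by
  rw [← Matrix.mul_assoc]
  ext p q
  rw [Matrix.mul_apply, Finset.sum_eq_single p]
  · rw [B0_mul_transpose_apply]
    by_cases h : codist n p = 0
    · simp [h]
    · simp [h, K, last_iff]
  · intro s _ hs
    rw [B0_mul_transpose_apply, if_neg, zero_mul]
    exact fun h => hs (idx_ext h.1.symm (h.2.2.trans h.2.1.symm))
  · simp

variable (n) in
/-- The right-hand side of the closed-loop system, in which the terms with `K` cancel. -/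
noncomputable def loopField (a₀ : ℝ) (M : Matrix (Idx n) (Idx n) ℝ) (x : State n) : State n :=
  act (A0 n) x + act M x - (1 / 2 : ℝ) • act (B0 n * ((B0 n)ᵀ * D n (Theta n a₀ x) * F n *
    D n (Theta n a₀ x))) x

lemma closedLoop_eq (k : Matrix (Fin r) (Idx n) ℝ) (R : ℝ → State n → Matrix (Idx n) (Idx n) ℝ)
    (a₀ t : ℝ) (x : State n) :
    closedLoop n k R (control n k a₀) t x = loopField n a₀ (R t x) x := by
  have hneg : ∀ v : Control r, act (B0 n) (-v) = -act (B0 n) v := fun v => by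
    rw [← neg_one_smul ℝ, act_smul, neg_one_smul]
  rw [closedLoop, control, loopField, hneg, add_act, add_act, add_act, smul_act, act_add, act_smul,
    act_act, act_act, B0_mul_transpose_mul_K]
  abel

/-- Neighbouring exponents differ by one and the last one in each block is 1/2, so A₀, M and the
feedback all scale by the same factor Θ⁻¹. -/
lemma act_D_loopField (a₀ : ℝ) {M : Matrix (Idx n) (Idx n) ℝ}
    (hM : ∀ p q, ¬ IsSuperdiag n p q → M p q = 0) {x : State n} (hθ : 0 < Theta n a₀ x) :
    act (D n (Theta n a₀ x)) (loopField n a₀ M x) = (Theta n a₀ x)⁻¹ •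
      act (A0 n + M - (1 / 2 : ℝ) • (B0 n * (B0 n)ᵀ * F n)) (act (D n (Theta n a₀ x)) x) := by
  set θ := Theta n a₀ x with hθdef
  have hA : ∀ p q, ¬ IsSuperdiag n p q → A0 n p q = 0 := fun p q h => by rw [A0_apply, if_neg h]
  have hB : D n θ * (B0 n * ((B0 n)ᵀ * D n θ * F n * D n θ))
      = θ⁻¹ • (B0 n * (B0 n)ᵀ * F n * D n θ) := by
    rw [← Matrix.mul_assoc, D_mul_B0, B0_transpose_mul_D]
    simp only [Matrix.smul_mul, Matrix.mul_smul, smul_smul, Matrix.mul_assoc]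
    rw [← Real.rpow_add hθ]
    congr 1
    rw [← Real.rpow_neg_one]
    norm_num
  rw [loopField, ← hθdef, act_sub, act_add, act_smul, act_act, act_act, act_act,
    D_mul_of_superdiag hA hθ, D_mul_of_superdiag hM hθ, hB, smul_act, smul_act, smul_act,
    act_act, Matrix.sub_mul, Matrix.add_mul, Matrix.smul_mul, sub_eq_add_neg, sub_eq_add_neg,
    add_act, add_act, ← neg_smul, ← neg_smul, smul_act, smul_add, smul_add, smul_comm]

/-- The derivative of the controllability function along the closed-loop system. -/
lemma fderiv_Theta_loopField_le {γ δ a₀ : ℝ} (hγ : γ ≤ 1)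
    (hδ : δ = (1 - γ) / specRad (Gtilde n)) (ha0 : 0 < a₀) {M : Matrix (Idx n) (Idx n) ℝ}
    (hM0 : ∀ p q, ¬ IsSuperdiag n p q → M p q = 0) (hM : ∀ p q, IsSuperdiag n p q → |M p q| ≤ δ)
    {x : State n} (hx : x ≠ 0) :
    fderiv ℝ (Theta n a₀) x (loopField n a₀ M x) ≤ -γ := by
  have h := fderiv_Theta_apply ha0 hx (loopField n a₀ M x)
  have hθ := Theta_pos ha0 hx
  rw [act_D_loopField a₀ hM0 hθ] at h
  set θ := Theta n a₀ x
  set y := act (D n θ) x with hy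
  have hF1 : 0 < quadForm (F1 n) y := posDef_quadForm_pos F1_posDef (act_D_ne_zero hθ hx)
  have hpert := perturbation_quadratic_le hγ hδ hM0 hM y.ofLp
  -- The factor ½ in the control is exactly what symmetrization turns into the quadratic term of the
  -- Riccati equation.
  have hmat : F n * (A0 n + M - (1 / 2 : ℝ) • (B0 n * (B0 n)ᵀ * F n))
      + (A0 n + M - (1 / 2 : ℝ) • (B0 n * (B0 n)ᵀ * F n))ᵀ * F n
      = -F1 n + (F n * M + Mᵀ * F n) := by
    rw [← riccati_F]
    simp only [Matrix.transpose_sub, Matrix.transpose_add, Matrix.transpose_smul,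
      Matrix.transpose_mul, Matrix.transpose_transpose, F_transpose, Matrix.mul_sub,
      Matrix.sub_mul, Matrix.mul_add, Matrix.add_mul, Matrix.mul_smul, Matrix.smul_mul,
      Matrix.mul_assoc]
    module
  set N := A0 n + M - (1 / 2 : ℝ) • (B0 n * (B0 n)ᵀ * F n)
  have hsym : 2 * ((F n *ᵥ y.ofLp) ⬝ᵥ (N *ᵥ y.ofLp))
      = y.ofLp ⬝ᵥ ((F n * N + Nᵀ * F n) *ᵥ y.ofLp) := by
    have h1 : y.ofLp ⬝ᵥ ((F n * N) *ᵥ y.ofLp) = (F n *ᵥ y.ofLp) ⬝ᵥ (N *ᵥ y.ofLp) := by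
      rw [← Matrix.mulVec_mulVec, Matrix.dotProduct_mulVec, ← Matrix.mulVec_transpose, F_transpose]
    have h2 : y.ofLp ⬝ᵥ ((Nᵀ * F n) *ᵥ y.ofLp) = (F n *ᵥ y.ofLp) ⬝ᵥ (N *ᵥ y.ofLp) := by
      rw [← Matrix.mulVec_mulVec, Matrix.dotProduct_mulVec, Matrix.vecMul_transpose,
        dotProduct_comm]
    rw [Matrix.add_mulVec, dotProduct_add, h1, h2]
    ring
  rw [WithLp.ofLp_smul, dotProduct_smul, smul_eq_mul, ofLp_act N] at h
  have h3 : 2 * θ * (θ⁻¹ * ((F n *ᵥ y.ofLp) ⬝ᵥ (N *ᵥ y.ofLp)))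
      = 2 * ((F n *ᵥ y.ofLp) ⬝ᵥ (N *ᵥ y.ofLp)) := by
    field_simp
  rw [h3, hsym, hmat, Matrix.add_mulVec, dotProduct_add, Matrix.neg_mulVec, dotProduct_neg] at h
  have h4 : y.ofLp ⬝ᵥ (F1 n *ᵥ y.ofLp) = quadForm (F1 n) y := dotProduct_comm _ _
  rw [h4] at h hpert
  refine le_of_mul_le_mul_right ?_ hF1
  linarith

lemma hasDerivWithinAt_Theta_comp {a₀ : ℝ} (ha0 : 0 < a₀) {x : ℝ → State n} {v : State n}
    {s : Set ℝ} {t : ℝ} (hx : x t ≠ 0) (h : HasDerivWithinAt x v s t) :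
    HasDerivWithinAt (fun u => Theta n a₀ (x u)) (fderiv ℝ (Theta n a₀) (x t) v) s t :=
  ((contDiffAt_Theta ha0 hx).differentiableAt
    one_ne_zero).hasFDerivAt.comp_hasDerivWithinAt t h

/-! ### The bound on the control -/

section ControlBound

lemma norm_le_of_Theta [NeZero r] (hn : Antitone n) {a₀ : ℝ} (ha0 : 0 < a₀) {x : State n}
    (hx : x ≠ 0) : ‖x‖ ≤ max (Theta n a₀ x ^ n 0) (Theta n a₀ x) *
      Real.sqrt (opNorm (Finv n) * (2 * a₀)) := by
  have hθ := Theta_pos ha0 hx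
  have hy := norm_act_D_Theta_sq_le ha0 hx
  set θ := Theta n a₀ x
  set m := max (θ ^ n 0) θ with hm
  have hm0 : 0 ≤ m := hθ.le.trans (le_max_right _ _)
  have h1 : θ * ‖x‖ ^ 2 ≤ m ^ 2 * ‖act (D n θ) x‖ ^ 2 := by
    rw [EuclideanSpace.norm_sq_eq, EuclideanSpace.norm_sq_eq, Finset.mul_sum, Finset.mul_sum]
    refine Finset.sum_le_sum fun p _ => ?_
    have hxp : x p = θ ^ (expo n p) * act (D n θ) x p := by
      rw [act_D_apply, ← mul_assoc, ← Real.rpow_add hθ]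
      simp
    -- The power codist + 1 lies between 1 and n₁, so the extreme powers dominate: θ when θ ≤ 1, and
    -- θ^{n₁} when θ ≥ 1.
    have h2 : θ ^ (codist n p + 1) ≤ m := by
      rcases le_total θ 1 with h | h
      · refine le_trans ?_ (le_max_right _ _)
        simpa using pow_le_pow_of_le_one hθ.le h (Nat.le_add_left 1 (codist n p))
      · refine le_trans ?_ (le_max_left _ _)
        refine pow_le_pow_right₀ h ((codist_lt p).trans_le (hn (Fin.zero_le p.1)))
    have h3 : θ * (θ ^ expo n p) ^ 2 = (θ ^ (codist n p + 1)) ^ 2 := by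
      rw [expo_eq, Real.rpow_add hθ, Real.rpow_natCast, mul_pow, ← Real.sqrt_eq_rpow,
        Real.sq_sqrt hθ.le]
      ring
    rw [hxp, norm_mul, mul_pow, ← mul_assoc, Real.norm_of_nonneg (by positivity : 0 ≤ θ ^ expo n p),
      h3]
    gcongr
  have h4 : θ * ‖x‖ ^ 2 ≤ θ * (m ^ 2 * (opNorm (Finv n) * (2 * a₀))) := by
    refine h1.trans ((mul_le_mul_of_nonneg_left hy (sq_nonneg m)).trans (le_of_eq ?_))
    ring
  have h5 := le_of_mul_le_mul_left h4 hθ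
  rw [← Real.sqrt_sq hm0, ← Real.sqrt_mul (sq_nonneg m)]
  exact Real.le_sqrt_of_sq_le h5

/-- The factor Θ^{-1/2} from B₀*D(Θ) cancels the √Θ in the bound for ‖D(Θ)x‖, so the estimate does
not depend on x. -/
lemma norm_act_feedback_le {a₀ : ℝ} (ha0 : 0 < a₀) {x : State n} (hx : x ≠ 0) :
    ‖act ((B0 n)ᵀ * D n (Theta n a₀ x) * F n * D n (Theta n a₀ x)) x‖ ≤
      opNorm ((B0 n)ᵀ * F n) * Real.sqrt (opNorm (Finv n) * (2 * a₀)) := by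
  have hθ := Theta_pos ha0 hx
  have hy := norm_act_D_Theta_sq_le ha0 hx
  set θ := Theta n a₀ x
  rw [← act_act, B0_transpose_mul_D, Matrix.smul_mul, smul_act, norm_smul,
    Real.norm_of_nonneg (by positivity)]
  have h1 : ‖act (D n θ) x‖ ≤ Real.sqrt (opNorm (Finv n) * (2 * a₀)) * Real.sqrt θ := by
    rw [← Real.sqrt_mul' _ hθ.le]
    refine Real.le_sqrt_of_sq_le (hy.trans (le_of_eq ?_))
    ring
  have h2 := (norm_act_le ((B0 n)ᵀ * F n) (act (D n θ) x)).trans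
    (mul_le_mul_of_nonneg_left h1 (opNorm_nonneg _))
  have h3 : θ ^ (-(1 / 2) : ℝ) * Real.sqrt θ = 1 := by
    rw [Real.sqrt_eq_rpow, ← Real.rpow_add hθ]
    simp
  calc _ ≤ θ ^ (-(1 / 2) : ℝ) * (opNorm ((B0 n)ᵀ * F n) *
        (Real.sqrt (opNorm (Finv n) * (2 * a₀)) * Real.sqrt θ)) := by gcongr
    _ = θ ^ (-(1 / 2) : ℝ) * Real.sqrt θ * (opNorm ((B0 n)ᵀ * F n) *
        Real.sqrt (opNorm (Finv n) * (2 * a₀))) := by ring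
    _ = _ := by rw [h3, one_mul]

lemma norm_control_le [NeZero r] (hn : Antitone n) (k : Matrix (Fin r) (Idx n) ℝ) {a₀ b : ℝ}
    (ha0 : 0 < a₀) (ha : a₀ ≤ 2 / (opNorm (Finv n) * (opNorm ((B0 n)ᵀ * F n) + 2 * b) ^ 2))
    {x : State n}
    (hb : max (Theta n a₀ x ^ n 0) (Theta n a₀ x) * opNorm ((B0 n)ᵀ * K n k) ≤ b) :
    ‖control n k a₀ x‖ ≤ 1 := by
  rcases eq_or_ne x 0 with rfl | hx
  · rw [control, act_zero]
    simp
  have h1 := norm_act_feedback_le ha0 hx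
  have h2 := norm_le_of_Theta hn ha0 hx
  set β := opNorm ((B0 n)ᵀ * F n)
  set N := opNorm (Finv n) with hN
  have hN0 : 0 ≤ N := opNorm_nonneg _
  set S := Real.sqrt (N * (2 * a₀)) with hS
  set m := max (Theta n a₀ x ^ n 0) (Theta n a₀ x)
  have h3 : ‖act ((B0 n)ᵀ * K n k) x‖ ≤ b * S := by
    refine (norm_act_le _ _).trans ((mul_le_mul_of_nonneg_left h2 (opNorm_nonneg _)).trans ?_)
    rw [← mul_assoc, mul_comm (opNorm _) m]
    exact mul_le_mul_of_nonneg_right hb (Real.sqrt_nonneg _)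
  have h4 : ‖control n k a₀ x‖ ≤ 1 / 2 * (β * S) + b * S := by
    rw [control, norm_neg, add_act, smul_act]
    refine (norm_add_le _ _).trans (add_le_add ?_ h3)
    rw [norm_smul, Real.norm_of_nonneg (by norm_num)]
    gcongr
  -- A zero denominator would make the quotient in `ha` equal to 0, against a₀ > 0.
  have h5 : 0 < N * (β + 2 * b) ^ 2 := by
    by_contra h
    have h6 : 2 / (N * (β + 2 * b) ^ 2) ≤ 0 := div_nonpos_of_nonneg_of_nonpos zero_le_two (not_lt.1 h)
    linarith
  have h6 : a₀ * (N * (β + 2 * b) ^ 2) ≤ 2 := (le_div_iff₀ h5).1 ha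
  refine h4.trans (abs_le_of_sq_le_sq' ?_ zero_le_one).2
  have hSq : S ^ 2 = N * (2 * a₀) := Real.sq_sqrt (by positivity)
  calc (1 / 2 * (β * S) + b * S) ^ 2 = 1 / 4 * (S ^ 2 * (β + 2 * b) ^ 2) := by ring
    _ = 1 / 2 * (a₀ * (N * (β + 2 * b) ^ 2)) := by rw [hSq]; ring
    _ ≤ 1 ^ 2 := by linarith

end ControlBound

/-! ### Existence for a field retracted to a compact convex set -/

section ODE

variable {E : Type*} [NormedAddCommGroup E] [InnerProductSpace ℝ E] [CompleteSpace E]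

/-- The metric projection onto a closed convex set is nonexpansive. -/
lemma exists_nonexpansive_retraction {C : Set E} (hne : C.Nonempty) (hcl : IsClosed C)
    (hconv : Convex ℝ C) :
    ∃ π : E → E, LipschitzWith 1 π ∧ (∀ z, π z ∈ C) ∧ ∀ z ∈ C, π z = z := by
  choose π hπC hπ using exists_norm_eq_iInf_of_complete_convex hne hcl.isComplete hconv
  have hvar : ∀ z, ∀ w ∈ C, inner ℝ (z - π z) (w - π z) ≤ 0 := fun z =>
    (norm_eq_iInf_iff_real_inner_le_zero hconv (hπC z)).1 (hπ z)
  refine ⟨π, LipschitzWith.of_dist_le_mul fun x y => ?_, hπC, fun z hz => ?_⟩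
  · rw [dist_eq_norm, dist_eq_norm, NNReal.coe_one, one_mul]
    have h1 := hvar x (π y) (hπC y)
    have h2 := hvar y (π x) (hπC x)
    have h3 : ‖π x - π y‖ ^ 2 ≤ inner ℝ (x - y) (π x - π y) := by
      rw [← real_inner_self_eq_norm_sq]
      have h4 : inner ℝ (x - y) (π x - π y) - inner ℝ (π x - π y) (π x - π y)
          = -(inner ℝ (x - π x) (π y - π x) + inner ℝ (y - π y) (π x - π y)) := by
        simp only [inner_sub_left, inner_sub_right]
        ring
      linarith
    have h5 := h3.trans (real_inner_le_norm _ _)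
    rcases (norm_nonneg (π x - π y)).eq_or_lt with h6 | h6
    · rw [← h6]
      positivity
    · rw [sq] at h5
      exact le_of_mul_le_mul_right h5 h6
  · have h := hvar z z hz
    rw [real_inner_self_eq_norm_sq] at h
    have h0 : ‖z - π z‖ = 0 := by
      have := sq_nonneg ‖z - π z‖
      exact pow_eq_zero_iff two_ne_zero |>.1 (le_antisymm h this)
    exact (sub_eq_zero.1 (norm_eq_zero.1 h0)).symm

/-- Global existence for the field `h(t, π x)`, where `π` is a retraction onto a compact convex
set on which `h` is Lipschitz. -/
lemma exists_solution_of_retraction {C : Set E} (hC : IsCompact C) (hconv : Convex ℝ C)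
    {T : ℝ} (hT : 0 ≤ T) {h : ℝ → E → E} {L : NNReal}
    (hLip : ∀ t ∈ Icc 0 T, LipschitzOnWith L (h t) C)
    (hcont : ContinuousOn (Function.uncurry h) (Icc 0 T ×ˢ C)) {x₀ : E} (hx₀ : x₀ ∈ C) :
    ∃ (π : E → E) (x : ℝ → E), (∀ z, π z ∈ C) ∧ (∀ z ∈ C, π z = z) ∧ x 0 = x₀ ∧
      ∀ t ∈ Icc 0 T, HasDerivWithinAt x (h t (π (x t))) (Icc 0 T) t := by
  obtain ⟨π, hπ, hπC, hπid⟩ := exists_nonexpansive_retraction ⟨x₀, hx₀⟩ hC.isClosed hconv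
  obtain ⟨B, hB⟩ := (isCompact_Icc.prod hC).exists_bound_of_continuousOn hcont
  let M : NNReal := ⟨max B 0, le_max_right _ _⟩
  -- The retracted field is globally Lipschitz in z and bounded by M, so a ball of radius MT about
  -- x₀ allows the whole interval [0, T].
  have hPL : IsPicardLindelof (fun t z => h t (π z)) (⟨0, left_mem_Icc.2 hT⟩ : Icc (0 : ℝ) T) x₀
      (M * T.toNNReal) 0 M (L * 1) :=
    { lipschitzOnWith := fun t ht =>
        (hLip t ht).comp (hπ.lipschitzOnWith) fun z _ => hπC z
      continuousOn := fun z _ =>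
        hcont.comp (f := fun t => (t, π z)) (by fun_prop) fun t ht => ⟨ht, hπC z⟩
      norm_le := fun t ht z _ => (hB (t, π z) ⟨ht, hπC z⟩).trans (le_max_left _ _)
      mul_max_le := by
        rw [sub_zero, sub_self, max_eq_left hT, NNReal.coe_zero, sub_zero]
        rw [NNReal.coe_mul, Real.coe_toNNReal T hT] }
  obtain ⟨x, hx0, hx⟩ := hPL.exists_eq_forall_mem_Icc_hasDerivWithinAt₀
  exact ⟨π, x, hπC, hπid, hx0, hx⟩

end ODE

/-! ### Trajectories and their uniqueness -/

lemma IsTrajectory.restrict {f : ℝ → State n → State n} {Q : Set (State n)} {x₀ : State n}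
    {T T' : ℝ} {x : ℝ → State n} (h : IsTrajectory n f Q x₀ T x) (hT : T' ≤ T) :
    IsTrajectory n f Q x₀ T' x where
  init := h.init
  mem t ht := h.mem t ⟨ht.1, ht.2.trans hT⟩
  cont := h.cont.mono (Icc_subset_Icc_right hT)
  ode t ht := (h.ode t ⟨ht.1, ht.2.trans_le hT⟩).mono (Icc_subset_Icc_right hT)

lemma IsTrajectory.mono {f : ℝ → State n → State n} {Q Q' : Set (State n)} {x₀ : State n}
    {T : ℝ} {x : ℝ → State n} (h : IsTrajectory n f Q x₀ T x) (hQ : Q ⊆ Q') :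
    IsTrajectory n f Q' x₀ T x where
  init := h.init
  mem t ht := hQ (h.mem t ht)
  cont := h.cont
  ode := h.ode

lemma hasDerivWithinAt_Ici_of_Icc {E : Type*} [NormedAddCommGroup E] [NormedSpace ℝ E]
    {x : ℝ → E} {v : E} {a b t : ℝ} (ht : t ∈ Ico a b)
    (h : HasDerivWithinAt x v (Icc a b) t) : HasDerivWithinAt x v (Ici t) t :=
  h.mono_of_mem_nhdsWithin (mem_of_superset (Icc_mem_nhdsGE ht.2) (Icc_subset_Icc_left ht.1))

/-- Uniqueness of trajectories along which the right-hand side is locally Lipschitz in `x`,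
uniformly in `t`. -/
lemma IsTrajectory.eqOn {f : ℝ → State n → State n} {Q : Set (State n)} {x₀ : State n}
    {T : ℝ} {x y : ℝ → State n} (hx : IsTrajectory n f Q x₀ T x) (hy : IsTrajectory n f Q x₀ T y)
    (hloc : ∀ t ∈ Ico 0 T, ∃ U ∈ 𝓝 (x t), ∃ L : NNReal, ∀ s, 0 ≤ s →
      LipschitzOnWith L (f s) (U ∩ Q)) :
    EqOn x y (Icc 0 T) := by
  rcases lt_or_ge T 0 with hT | hT
  · rw [Icc_eq_empty (not_le.2 hT)]
    exact eqOn_empty _ _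
  -- Continuation: the agreement set is closed, contains 0, and extends to the right of each of its
  -- points because both curves stay for a while in one Lipschitz neighbourhood.
  have hclosed : IsClosed ({t | x t = y t} ∩ Icc 0 T) := by
    have := (hx.cont.prodMk hy.cont).preimage_isClosed_of_isClosed isClosed_Icc isClosed_diagonal
    rwa [inter_comm] at this
  refine hclosed.Icc_subset_of_forall_exists_gt (hx.init.trans hy.init.symm) ?_
  rintro t ⟨hxy, ht⟩ u hu
  obtain ⟨U, hU, L, hL⟩ := hloc t ht
  have hcx : ∀ᶠ s in 𝓝[Icc 0 T] t, x s ∈ U := hx.cont t (Ico_subset_Icc_self ht) hU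
  have hcy : ∀ᶠ s in 𝓝[Icc 0 T] t, y s ∈ U := by
    have hxy' : x t = y t := hxy
    rw [hxy'] at hU
    exact hy.cont t (Ico_subset_Icc_self ht) hU
  obtain ⟨η, hη, hball⟩ := Metric.mem_nhdsWithin_iff.1 (hcx.and hcy)
  set b := min (min u T) (t + η / 2) with hb
  have htb : t < b := lt_min (lt_min hu ht.2) (by linarith)
  have hbT : b ≤ T := (min_le_left _ _).trans (min_le_right _ _)
  have hsub : Icc t b ⊆ Icc 0 T := Icc_subset_Icc ht.1 hbT
  have hUs : ∀ s ∈ Icc t b, x s ∈ U ∧ y s ∈ U := fun s hs => hball ⟨by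
    rw [Metric.mem_ball, Real.dist_eq, abs_of_nonneg (by linarith [hs.1])]
    have : b ≤ t + η / 2 := min_le_right _ _
    linarith [hs.2], hsub hs⟩
  have hIco : ∀ s ∈ Ico t b, s ∈ Ico 0 T := fun s hs =>
    ⟨ht.1.trans hs.1, hs.2.trans_le hbT⟩
  have heq := ODE_solution_unique_of_mem_Icc_right (v := f) (s := fun _ => U ∩ Q) (K := L)
    (f := x) (g := y) (a := t) (b := b)
    (fun s hs => hL s (ht.1.trans hs.1)) (hx.cont.mono hsub)
    (fun s hs => hasDerivWithinAt_Ici_of_Icc (hIco s hs) (hx.ode s (hIco s hs)))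
    (fun s hs => ⟨(hUs s (Ico_subset_Icc_self hs)).1, hx.mem s (hsub (Ico_subset_Icc_self hs))⟩)
    (hy.cont.mono hsub)
    (fun s hs => hasDerivWithinAt_Ici_of_Icc (hIco s hs) (hy.ode s (hIco s hs)))
    (fun s hs => ⟨(hUs s (Ico_subset_Icc_self hs)).2, hy.mem s (hsub (Ico_subset_Icc_self hs))⟩)
    hxy
  exact ⟨b, heq (right_mem_Icc.2 htb.le), htb, (min_le_left _ _).trans (min_le_left _ _)⟩

/-! ### Regularity of the closed-loop field off the origin -/

variable (n) in
/-- The part of the closed-loop right-hand side that does not depend on the perturbation. -/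
noncomputable def nominalField (a₀ : ℝ) (x : State n) : State n :=
  loopField n a₀ 0 x

lemma loopField_eq (a₀ : ℝ) (M : Matrix (Idx n) (Idx n) ℝ) (x : State n) :
    loopField n a₀ M x = nominalField n a₀ x + act M x := by
  have h : act (0 : Matrix (Idx n) (Idx n) ℝ) x = 0 := by
    ext i
    simp [ofLp_act]
  rw [nominalField, loopField, loopField, h]
  abel

lemma contDiff_act {ι κ : Type} [Fintype ι] [Fintype κ] (M : Matrix ι κ ℝ) :
    ContDiff ℝ 1 (act M : EuclideanSpace ℝ κ → EuclideanSpace ℝ ι) := by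
  rw [contDiff_euclidean]
  intro i
  simp only [act_apply]
  fun_prop

lemma contDiffAt_nominalField {a₀ : ℝ} (ha0 : 0 < a₀) {x : State n} (hx : x ≠ 0) :
    ContDiffAt ℝ 1 (nominalField n a₀) x := by
  have hD : ∀ {g : State n → State n}, ContDiffAt ℝ 1 g x →
      ContDiffAt ℝ 1 (fun z => act (D n (Theta n a₀ z)) (g z)) x := by
    intro g hg
    rw [contDiffAt_euclidean] at hg ⊢
    intro p
    simp only [act_D_apply]
    exact ((contDiffAt_Theta ha0 hx).rpow_const_of_ne (Theta_pos ha0 hx).ne').mul (hg p)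
  have h1 : nominalField n a₀ = fun z => act (A0 n) z - (1 / 2 : ℝ) • act (B0 n * (B0 n)ᵀ)
      (act (D n (Theta n a₀ z)) (act (F n) (act (D n (Theta n a₀ z)) z))) := by
    ext z : 1
    have h : act (0 : Matrix (Idx n) (Idx n) ℝ) z = 0 := by
      ext i
      simp [ofLp_act]
    rw [nominalField, loopField, h, add_zero]
    simp only [act_act, Matrix.mul_assoc]
  rw [h1]
  have h2 : ContDiffAt ℝ 1 (fun z => act (F n) (act (D n (Theta n a₀ z)) z)) x :=
    (contDiff_act (F n)).contDiffAt.comp x (hD contDiffAt_id)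
  exact (contDiff_act (A0 n)).contDiffAt.sub
    (((contDiff_act (B0 n * (B0 n)ᵀ)).contDiffAt.comp x (hD h2)).const_smul (1 / 2 : ℝ))

lemma lipschitzOnWith_act_perturbation {Q : Set (State n)} {Δ : ℝ}
    {R : ℝ → State n → Matrix (Idx n) (Idx n) ℝ} (hR : Admissible n Q Δ R) (ρ : ℝ) :
    ∃ L : NNReal, ∀ t, 0 ≤ t →
      LipschitzOnWith L (fun x => act (R t x) x) (Metric.closedBall 0 ρ ∩ Q) := by
  obtain ⟨L, hL⟩ := hR.lipschitz ρ
  refine ⟨L.toNNReal, fun t ht => LipschitzOnWith.of_dist_le_mul fun x hx y hy => ?_⟩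
  rw [dist_eq_norm, dist_eq_norm]
  refine (hL t ht y hy.2 x hx.2 (by simpa using hy.1) (by simpa using hx.1)).trans ?_
  exact mul_le_mul_of_nonneg_right (Real.le_coe_toNNReal L) (norm_nonneg _)

lemma exists_lipschitzOnWith_loopField {Q : Set (State n)} {Δ a₀ : ℝ} (ha0 : 0 < a₀)
    {R : ℝ → State n → Matrix (Idx n) (Idx n) ℝ} (hR : Admissible n Q Δ R) {x : State n}
    (hx : x ≠ 0) : ∃ U ∈ 𝓝 x, ∃ L : NNReal, ∀ t, 0 ≤ t →
      LipschitzOnWith L (fun z => loopField n a₀ (R t z) z) (U ∩ Q) := by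
  obtain ⟨L₁, U, hU, h1⟩ := (contDiffAt_nominalField ha0 hx).exists_lipschitzOnWith
  obtain ⟨L₂, h2⟩ := lipschitzOnWith_act_perturbation hR (‖x‖ + 1)
  refine ⟨U ∩ Metric.closedBall 0 (‖x‖ + 1), inter_mem hU ?_, L₁ + L₂, fun t ht => ?_⟩
  · exact mem_of_superset (Metric.isOpen_ball.mem_nhds (by simp)) Metric.ball_subset_closedBall
  · simp only [loopField_eq]
    exact (h1.mono fun z hz => hz.1.1).add ((h2 t ht).mono fun z hz => ⟨hz.1.2, hz.2⟩)

lemma continuousOn_act_perturbation {Q : Set (State n)} {Δ : ℝ}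
    {R : ℝ → State n → Matrix (Idx n) (Idx n) ℝ} (hR : Admissible n Q Δ R) :
    ContinuousOn (fun z : ℝ × State n => act (R z.1 z.2) z.2) (Ici 0 ×ˢ Q) := by
  refine (PiLp.continuous_toLp 2 _).comp_continuousOn (continuousOn_pi.2 fun p => ?_)
  simp only [Matrix.mulVec, dotProduct]
  refine continuousOn_finsetSum _ fun q _ => (hR.continuous p q).mul ?_
  exact Continuous.continuousOn (by fun_prop)

lemma exists_Theta_le_imp_norm_lt {a₀ : ℝ} (ha0 : 0 < a₀) {η : ℝ} (hη : 0 < η) :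
    ∃ ε > 0, ∀ x : State n, Theta n a₀ x ≤ ε → ‖x‖ < η := by
  set N := opNorm (Finv n) * (2 * a₀) + 1 with hN
  have hN0 : 0 < N := by
    have := opNorm_nonneg (Finv n)
    positivity
  refine ⟨min 1 (η ^ 2 / (2 * N)), lt_min one_pos (by positivity), fun x hx => ?_⟩
  have h1 := norm_sq_le_of_Theta_le_one ha0 (hx.trans (min_le_left _ _))
  have h2 : Theta n a₀ x * (2 * N) ≤ η ^ 2 :=
    (le_div_iff₀ (by positivity)).1 (hx.trans (min_le_right _ _))
  have h3 := Theta_nonneg ha0 x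
  refine lt_of_pow_lt_pow_left₀ 2 hη.le ?_
  have h4 : opNorm (Finv n) * (2 * a₀ * Theta n a₀ x) ≤ N * Theta n a₀ x := by
    rw [hN]
    linarith
  have h5 : 0 < η ^ 2 := by positivity
  linarith

/-- A `C¹` modification near the origin of a vector field that is `C¹` off the origin. -/
lemma exists_contDiff_eq_off_ball {E G : Type*} [NormedAddCommGroup E] [InnerProductSpace ℝ E]
    [NormedAddCommGroup G] [NormedSpace ℝ G] {g : E → G} (hg : ∀ x ≠ 0, ContDiffAt ℝ 1 g x)
    {δ : ℝ} (hδ : 0 < δ) : ∃ g' : E → G, ContDiff ℝ 1 g' ∧ ∀ x, δ ≤ ‖x‖ → g' x = g x := by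
  let χ : ContDiffBump (0 : E) := ⟨δ / 2, δ, by positivity, by linarith⟩
  refine ⟨fun x => (1 - χ x) • g x, ?_, fun x hx => ?_⟩
  · rw [contDiff_iff_contDiffAt]
    intro x
    rcases eq_or_ne x 0 with rfl | hx
    · refine (contDiffAt_const (c := (0 : G))).congr_of_eventuallyEq ?_
      filter_upwards [χ.eventuallyEq_one] with z hz
      rw [hz, Pi.one_apply, sub_self, zero_smul]
    · exact (contDiffAt_const.sub χ.contDiffAt).smul (hg x hx)
  · simp only
    rw [χ.zero_of_le_dist (by simpa using hx), sub_zero, one_smul]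

/-! ### Descent of Θ and arrival at the origin -/

/-- The controllability function decreases along trajectories at least with the rate `γ`. -/
lemma antitoneOn_Theta_add {Q : Set (State n)} {γ Δ a₀ : ℝ} (hγ : γ ≤ 1)
    (hΔ : Δ = (1 - γ) / specRad (Gtilde n)) (ha0 : 0 < a₀)
    {R : ℝ → State n → Matrix (Idx n) (Idx n) ℝ} (hR : Admissible n Q Δ R) {x₀ : State n} {T : ℝ}
    {x : ℝ → State n} (h : IsTrajectory n (fun t x => loopField n a₀ (R t x) x) Q x₀ T x)
    (hne : ∀ t ∈ Icc 0 T, x t ≠ 0) :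
    AntitoneOn (fun t => Theta n a₀ (x t) + γ * t) (Icc 0 T) := by
  have hd : ∀ t ∈ interior (Icc 0 T), HasDerivAt (fun t => Theta n a₀ (x t) + γ * t)
      (fderiv ℝ (Theta n a₀) (x t) (loopField n a₀ (R t (x t)) (x t)) + γ * 1) t := by
    intro t ht
    rw [interior_Icc] at ht
    have h1 := (h.ode t (Ioo_subset_Ico_self ht)).hasDerivAt (Icc_mem_nhds ht.1 ht.2)
    have h2 := hasDerivWithinAt_Theta_comp ha0 (hne t (Ioo_subset_Icc_self ht))
      (h1.hasDerivWithinAt (s := univ))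
    rw [hasDerivWithinAt_univ] at h2
    exact h2.add ((hasDerivAt_id t).const_mul γ)
  refine antitoneOn_of_deriv_nonpos (convex_Icc 0 T) ?_
    (fun t ht => (hd t ht).differentiableAt.differentiableWithinAt) fun t ht => ?_
  · refine ContinuousOn.add (fun t ht => ?_) (by fun_prop)
    exact (contDiffAt_Theta ha0 (hne t ht)).continuousAt.comp_continuousWithinAt (h.cont t ht)
  · rw [(hd t ht).deriv]
    rw [interior_Icc] at ht
    have h3 := h.mem t (Ioo_subset_Icc_self ht)
    have := fderiv_Theta_loopField_le hγ hΔ ha0 (hR.superdiag t ht.1.le _ h3)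
      (hR.bound t ht.1.le _ h3) (hne t (Ioo_subset_Icc_self ht))
    linarith

/-- The trajectory from `x₀` exists until the controllability function drops to a given level. -/
lemma exists_trajectory_until {Q : Set (State n)} {γ Δ a₀ : ℝ} (hγ0 : 0 < γ) (hγ : γ ≤ 1)
    (hΔ : Δ = (1 - γ) / specRad (Gtilde n)) (ha0 : 0 < a₀)
    {R : ℝ → State n → Matrix (Idx n) (Idx n) ℝ} (hR : Admissible n Q Δ R) {x₀ : State n}
    (hQ : {x | Theta n a₀ x ≤ Theta n a₀ x₀} ⊆ Q) {ε : ℝ} (hε : 0 < ε) (hε0 : ε < Theta n a₀ x₀) :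
    ∃ (T : ℝ) (x : ℝ → State n), 0 ≤ T ∧ T ≤ Theta n a₀ x₀ / γ ∧
      IsTrajectory n (fun t x => loopField n a₀ (R t x) x) Q x₀ T x ∧
      (∀ t ∈ Ico 0 T, ε < Theta n a₀ (x t)) ∧ Theta n a₀ (x T) = ε := by
  set θ₀ := Theta n a₀ x₀ with hθ₀
  have hθ₀pos : 0 < θ₀ := hε.trans hε0
  set T₁ := θ₀ / γ with hT₁
  have hT₁pos : 0 < T₁ := by positivity
  set C := {x : State n | Theta n a₀ x ≤ θ₀} with hC
  have hx₀C : x₀ ∈ C := hθ₀.ge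
  have hCc : IsCompact C := isCompact_Theta_le ha0 hθ₀pos
  have hCconv : Convex ℝ C := convex_Theta_le ha0 hθ₀pos
  -- The ball of radius δ lies in {Θ ≤ ε/2}, so changing the field inside it does not affect motion
  -- at levels above ε/2.
  obtain ⟨δ, hδ, hball⟩ := Metric.mem_nhds_iff.1 (Theta_le_mem_nhds (n := n) ha0 (half_pos hε))
  have hfar : ∀ z : State n, ε / 2 < Theta n a₀ z → δ ≤ ‖z‖ := by
    intro z hz
    by_contra! h
    exact absurd (hball (mem_ball_zero_iff.2 h)) (not_le.2 hz)
  obtain ⟨g, hg, hgeq⟩ := exists_contDiff_eq_off_ball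
    (fun x hx => contDiffAt_nominalField (n := n) ha0 hx) hδ
  obtain ⟨L₁, hL₁⟩ := hg.contDiffOn.exists_lipschitzOnWith one_ne_zero hCconv hCc
  obtain ⟨ρ, hρ⟩ := hCc.isBounded.subset_closedBall 0
  obtain ⟨L₂, hL₂⟩ := lipschitzOnWith_act_perturbation hR ρ
  obtain ⟨π, x, -, hπid, hx0, hx⟩ := exists_solution_of_retraction hCc hCconv hT₁pos.le
    (h := fun t z => g z + act (R t z) z) (L := L₁ + L₂)
    (fun t ht => hL₁.add ((hL₂ t ht.1).mono fun z hz => ⟨hρ hz, hQ hz⟩))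
    (by
      refine ContinuousOn.add (hg.continuous.comp continuous_snd).continuousOn ?_
      exact (continuousOn_act_perturbation hR).mono (prod_mono Icc_subset_Ici_self hQ))
    hx₀C
  have hxc : ContinuousOn x (Icc 0 T₁) := fun t ht => (hx t ht).continuousWithinAt
  -- the solution up to the moment when the level `ε` is reached
  have hnorm : ∀ s ∈ Icc 0 T₁, 0 < s → (∀ t ∈ Ico 0 s, ε < Theta n a₀ (x t)) →
      ∀ t ∈ Icc 0 s, δ ≤ ‖x t‖ := by
    intro s hs hs0 h t ht
    have h1 : ∀ u ∈ Ico 0 s, δ ≤ ‖x u‖ := fun u hu => hfar _ (by linarith [h u hu])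
    have h2 : ContinuousOn (fun u => ‖x u‖) (closure (Ico 0 s)) := by
      rw [closure_Ico hs0.ne]
      exact (hxc.mono (Icc_subset_Icc_right hs.2)).norm
    refine le_on_closure (f := fun _ => δ) h1 continuousOn_const h2 ?_
    rwa [closure_Ico hs0.ne]
  have hne : ∀ z : State n, δ ≤ ‖z‖ → z ≠ 0 := fun z hz => norm_pos_iff.1 (hδ.trans_le hz)
  have hΘc : ∀ s ∈ Icc 0 T₁, 0 < s → (∀ t ∈ Ico 0 s, ε < Theta n a₀ (x t)) →
      ContinuousOn (fun t => Theta n a₀ (x t)) (Icc 0 s) := by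
    intro s hs hs0 h t ht
    exact (contDiffAt_Theta ha0 (hne _ (hnorm s hs hs0 h t ht))).continuousAt.comp_continuousWithinAt
      ((hxc.mono (Icc_subset_Icc_right hs.2)) t ht)
  -- On the level Θ = θ₀ the retraction is the identity, so the field there is the true one and Θ̇ ≤
  -- -γ < 0. The solution cannot leave C, hence the retraction is never active.
  have hmem : ∀ s ∈ Icc 0 T₁, 0 < s → (∀ t ∈ Ico 0 s, ε < Theta n a₀ (x t)) →
      ∀ t ∈ Icc 0 s, x t ∈ C := by
    intro s hs hs0 h
    have hsT : Icc 0 s ⊆ Icc 0 T₁ := Icc_subset_Icc_right hs.2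
    refine image_le_of_deriv_right_lt_deriv_boundary (B := fun _ => θ₀) (B' := fun _ => 0)
      (f' := fun t => fderiv ℝ (Theta n a₀) (x t) (g (π (x t)) + act (R t (π (x t))) (π (x t))))
      (hΘc s hs hs0 h) (fun t ht => ?_) ?_ (fun t => hasDerivAt_const t θ₀) fun t ht heq => ?_
    · refine hasDerivWithinAt_Theta_comp ha0
        (hne _ (hnorm s hs hs0 h t (Ico_subset_Icc_self ht))) ?_
      exact hasDerivWithinAt_Ici_of_Icc ht ((hx t (hsT (Ico_subset_Icc_self ht))).mono hsT)
    · rw [hx0]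
    · have hxC : x t ∈ C := heq.le
      have hδt := hnorm s hs hs0 h t (Ico_subset_Icc_self ht)
      rw [hπid _ hxC, hgeq _ hδt, ← loopField_eq]
      have := fderiv_Theta_loopField_le hγ hΔ ha0 (hR.superdiag t ht.1 _ (hQ hxC))
        (hR.bound t ht.1 _ (hQ hxC)) (hne _ hδt)
      linarith
  have htraj : ∀ s ∈ Icc 0 T₁, 0 < s → (∀ t ∈ Ico 0 s, ε < Theta n a₀ (x t)) →
      IsTrajectory n (fun t x => loopField n a₀ (R t x) x) Q x₀ s x := by
    intro s hs hs0 h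
    have hsT : Icc 0 s ⊆ Icc 0 T₁ := Icc_subset_Icc_right hs.2
    refine ⟨hx0, fun t ht => hQ (hmem s hs hs0 h t ht), hxc.mono hsT, fun t ht => ?_⟩
    have ht' := Ico_subset_Icc_self ht
    have h1 := (hx t (hsT ht')).mono hsT
    rwa [hπid _ (hmem s hs hs0 h t ht'), hgeq _ (hnorm s hs hs0 h t ht'), ← loopField_eq] at h1
  set S := Icc 0 T₁ ∩ x ⁻¹' {z | Theta n a₀ z ≤ ε} with hS
  have hSc : IsClosed S :=
    hxc.preimage_isClosed_of_isClosed isClosed_Icc (isClosed_Theta_le ha0 hε)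
  have hSne : S.Nonempty := by
    by_contra hempty
    rw [not_nonempty_iff_eq_empty] at hempty
    have h : ∀ t ∈ Icc 0 T₁, ε < Theta n a₀ (x t) := by
      intro t ht
      by_contra! hle
      exact (notMem_empty t) (hempty ▸ (⟨ht, hle⟩ : t ∈ S))
    have h0 : (0 : ℝ) ∈ Icc 0 T₁ := left_mem_Icc.2 hT₁pos.le
    have h1 : T₁ ∈ Icc 0 T₁ := right_mem_Icc.2 hT₁pos.le
    have h' : ∀ t ∈ Ico 0 T₁, ε < Theta n a₀ (x t) := fun t ht => h t (Ico_subset_Icc_self ht)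
    -- If the level ε were never reached, the decrease would give Θ ≤ θ₀ - γT₁ = 0 at time T₁.
    have hdec := antitoneOn_Theta_add hγ hΔ ha0 hR (htraj T₁ h1 hT₁pos h')
      (fun t ht => hne _ (hnorm T₁ h1 hT₁pos h' t ht)) h0 h1 hT₁pos.le
    simp only [hx0, mul_zero, add_zero, hT₁, mul_div_cancel₀ θ₀ hγ0.ne', ← hθ₀] at hdec
    have := h T₁ h1
    simp only [hT₁] at this
    linarith
  have hbdd : BddBelow S := ⟨0, fun t ht => ht.1.1⟩
  set T := sInf S with hT
  have hTS : T ∈ S := hSc.csInf_mem hSne hbdd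
  have hbefore : ∀ t ∈ Ico 0 T, ε < Theta n a₀ (x t) := by
    intro t ht
    by_contra! hle
    exact absurd (csInf_le hbdd (⟨⟨ht.1, ht.2.le.trans hTS.1.2⟩, hle⟩ : t ∈ S)) (not_le.2 ht.2)
  have hTpos : 0 < T := by
    refine hTS.1.1.lt_of_ne fun h => ?_
    have h2 : Theta n a₀ (x T) ≤ ε := hTS.2
    rw [← h, hx0] at h2
    exact absurd h2 (not_le.2 hε0)
  refine ⟨T, x, hTpos.le, hTS.1.2, htraj T hTS.1 hTpos hbefore, hbefore, le_antisymm hTS.2 ?_⟩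
  refine le_on_closure (s := Ico 0 T) (f := fun _ => ε) (g := fun t => Theta n a₀ (x t))
    (fun t ht => (hbefore t ht).le) continuousOn_const ?_ ?_
  · rw [closure_Ico hTpos.ne]
    exact hΘc T hTS.1 hTpos hbefore
  · rw [closure_Ico hTpos.ne]
    exact right_mem_Icc.2 hTpos.le

lemma eqOn_of_trajectories {Q : Set (State n)} {Δ a₀ : ℝ} (ha0 : 0 < a₀)
    {R : ℝ → State n → Matrix (Idx n) (Idx n) ℝ} (hR : Admissible n Q Δ R) {x₀ : State n} {T : ℝ}
    {x y : ℝ → State n}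
    (hx : IsTrajectory n (fun t x => loopField n a₀ (R t x) x) Q x₀ T x)
    (hy : IsTrajectory n (fun t x => loopField n a₀ (R t x) x) Q x₀ T y)
    (hne : ∀ t ∈ Ico 0 T, x t ≠ 0) : EqOn x y (Icc 0 T) :=
  hx.eqOn hy fun t ht => exists_lipschitzOnWith_loopField ha0 hR (hne t ht)

lemma exists_trajectory_to_origin {Q : Set (State n)} {γ Δ a₀ : ℝ} (hγ0 : 0 < γ) (hγ : γ ≤ 1)
    (hΔ : Δ = (1 - γ) / specRad (Gtilde n)) (ha0 : 0 < a₀)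
    {R : ℝ → State n → Matrix (Idx n) (Idx n) ℝ} (hR : Admissible n Q Δ R) {x₀ : State n}
    (hx₀ : x₀ ≠ 0) (hQ : {x | Theta n a₀ x ≤ Theta n a₀ x₀} ⊆ Q) :
    ∃ (T : ℝ) (x : ℝ → State n), 0 ≤ T ∧ T ≤ Theta n a₀ x₀ / γ ∧
      IsTrajectory n (fun t x => loopField n a₀ (R t x) x) Q x₀ T x ∧
      (∀ t ∈ Ico 0 T, x t ≠ 0) ∧ x T = 0 := by
  set θ₀ := Theta n a₀ x₀ with hθ₀
  have hθ₀pos : 0 < θ₀ := Theta_pos ha0 hx₀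
  -- The shift by 2 keeps every level strictly below θ₀.
  let ε : ℕ → ℝ := fun k => θ₀ / (k + 2)
  have hε : ∀ k, 0 < ε k := fun k => by positivity
  have hεlt : ∀ k, ε k < θ₀ := fun k => by
    rw [div_lt_iff₀ (by positivity)]
    have : (0 : ℝ) ≤ k := by positivity
    nlinarith
  have hεanti : StrictAnti ε := by
    refine strictAnti_nat_of_succ_lt fun k => ?_
    refine div_lt_div_of_pos_left hθ₀pos (by positivity) ?_
    push_cast
    linarith
  have hεlim : Tendsto ε atTop (𝓝 0) :=
    tendsto_const_nhds.div_atTop (tendsto_atTop_add_const_right _ _ tendsto_natCast_atTop_atTop)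
  choose τ ξ hτ0 hτle hξ hξlt hξτ using fun k =>
    exists_trajectory_until hγ0 hγ hΔ ha0 hR hQ (hε k) (hεlt k)
  have hξne : ∀ k, ∀ t ∈ Icc 0 (τ k), ξ k t ≠ 0 := by
    intro k t ht h0
    rcases ht.2.eq_or_lt with rfl | h
    · have := hξτ k
      rw [h0, Theta_zero] at this
      exact (hε k).ne this
    · have := hξlt k t ⟨ht.1, h⟩
      rw [h0, Theta_zero] at this
      exact absurd this (not_lt.2 (hε k).le)
  have hξge : ∀ k, ∀ t ∈ Icc 0 (τ k), ε k ≤ Theta n a₀ (ξ k t) := by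
    intro k t ht
    rcases ht.2.eq_or_lt with rfl | h
    · exact (hξτ k).ge
    · exact (hξlt k t ⟨ht.1, h⟩).le
  have hagree : ∀ k l, τ k ≤ τ l → EqOn (ξ k) (ξ l) (Icc 0 (τ k)) := fun k l hkl =>
    eqOn_of_trajectories ha0 hR (hξ k) ((hξ l).restrict hkl)
      fun t ht => hξne k t (Ico_subset_Icc_self ht)
  -- Were the lower level reached no later, the two pieces would agree up to that time, where the
  -- k-th one is still at or above its own level `ε k`.
  have hτmono : StrictMono τ := by
    refine strictMono_nat_of_lt_succ fun k => ?_
    by_contra! hle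
    have h1 := hagree (k + 1) k hle (right_mem_Icc.2 (hτ0 _))
    have h2 := hξge k (τ (k + 1)) ⟨hτ0 _, hle⟩
    rw [← h1, hξτ] at h2
    exact absurd h2 (not_le.2 (hεanti k.lt_succ_self))
  have hbdd : BddAbove (range τ) := ⟨θ₀ / γ, by
    rintro _ ⟨k, rfl⟩
    exact hτle k⟩
  set T := ⨆ k, τ k with hT
  have hτT : ∀ k, τ k < T := fun k =>
    (hτmono k.lt_succ_self).trans_le (le_ciSup hbdd (k + 1))
  have hex : ∀ t, t < T → ∃ k, t < τ k := fun t ht => exists_lt_of_lt_ciSup ht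
  have hTpos : 0 < T := (hτ0 0).trans_lt (hτT 0)
  classical
  -- The value 0 off all the pieces provides x(T) = 0.
  let x : ℝ → State n := fun t => if h : ∃ k, t < τ k then ξ (Nat.find h) t else 0
  have hxξ : ∀ k, ∀ t, 0 ≤ t → t < τ k → x t = ξ k t := by
    intro k t ht0 ht
    have h : ∃ k, t < τ k := ⟨k, ht⟩
    have h1 : x t = ξ (Nat.find h) t := dif_pos h
    rw [h1]
    exact hagree _ _ (hτmono.monotone (Nat.find_min' h ht)) ⟨ht0, (Nat.find_spec h).le⟩
  have hxT : x T = 0 := dif_neg fun ⟨k, hk⟩ => absurd hk (not_lt.2 (hτT k).le)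
  have hode : ∀ t ∈ Ico 0 T, HasDerivWithinAt x (loopField n a₀ (R t (x t)) (x t)) (Icc 0 T) t := by
    intro t ht
    obtain ⟨k, hk⟩ := hex t ht.2
    have h1 := (hξ k).ode t ⟨ht.1, hk⟩
    have hnhds : Icc 0 T ∩ Iio (τ k) ∈ 𝓝[Icc 0 T] t :=
      inter_mem self_mem_nhdsWithin (mem_nhdsWithin_of_mem_nhds (Iio_mem_nhds hk))
    have h2 : HasDerivWithinAt (ξ k) (loopField n a₀ (R t (ξ k t)) (ξ k t)) (Icc 0 T) t :=
      h1.mono_of_mem_nhdsWithin (mem_of_superset hnhds fun s hs => ⟨hs.1.1, hs.2.le⟩)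
    rw [hxξ k t ht.1 hk]
    exact h2.congr_of_eventuallyEq
      (mem_of_superset hnhds fun s hs => hxξ k s hs.1.1 hs.2) (hxξ k t ht.1 hk)
  -- After time `τ k` the level stays at most `ε k`; small Θ forces a small norm, so x is continuous
  -- at T.
  have hsmall : ∀ k, ∀ t ∈ Ico (τ k) T, Theta n a₀ (x t) ≤ ε k := by
    intro k t ht
    obtain ⟨l, hl⟩ := hex t ht.2
    have ht0 : 0 ≤ t := (hτ0 k).trans ht.1
    rw [hxξ l t ht0 hl]
    have hkl : τ k ≤ τ l := ht.1.trans hl.le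
    have h1 := antitoneOn_Theta_add hγ hΔ ha0 hR (hξ l) (hξne l) ⟨hτ0 k, hkl⟩ ⟨ht0, hl.le⟩ ht.1
    simp only at h1
    rw [← hagree k l hkl (right_mem_Icc.2 (hτ0 k)), hξτ] at h1
    have h2 := mul_le_mul_of_nonneg_left ht.1 hγ0.le
    linarith
  refine ⟨T, x, hTpos.le, ciSup_le hτle, ⟨?_, fun t ht => ?_, fun t ht => ?_, hode⟩,
    fun t ht => ?_, hxT⟩
  · obtain ⟨k, hk⟩ := hex 0 hTpos
    rw [hxξ k 0 le_rfl hk, (hξ k).init]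
  · rcases ht.2.eq_or_lt with rfl | h
    · rw [hxT]
      refine hQ ?_
      change Theta n a₀ 0 ≤ θ₀
      rw [Theta_zero]
      exact hθ₀pos.le
    · obtain ⟨k, hk⟩ := hex t h
      rw [hxξ k t ht.1 hk]
      exact (hξ k).mem t ⟨ht.1, hk.le⟩
  · rcases ht.2.eq_or_lt with rfl | h
    · rw [ContinuousWithinAt, hxT, Metric.tendsto_nhds]
      intro η hη
      obtain ⟨ε', hε', hsm⟩ := exists_Theta_le_imp_norm_lt (n := n) ha0 hη
      obtain ⟨k, hk⟩ := (hεlim.eventually (gt_mem_nhds hε')).exists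
      filter_upwards [self_mem_nhdsWithin, mem_nhdsWithin_of_mem_nhds (Ioi_mem_nhds (hτT k))]
        with t ht1 ht2
      rw [dist_zero_right]
      rcases ht1.2.eq_or_lt with rfl | h
      · rw [hxT, norm_zero]
        exact hη
      · exact hsm _ ((hsmall k t ⟨(mem_Ioi.1 ht2).le, h⟩).trans hk.le)
    · exact (hode t ⟨ht.1, h⟩).continuousWithinAt
  · obtain ⟨k, hk⟩ := hex t ht.2
    rw [hxξ k t ht.1 hk]
    exact hξne k t ⟨ht.1, hk.le⟩

/-! ### Assembly of the synthesis -/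

lemma solvesRobustSynthesis_of_bounded (k : Matrix (Fin r) (Idx n) ℝ) {Q : Set (State n)}
    {γ Δ a₀ : ℝ} (hγ0 : 0 < γ) (hγ : γ ≤ 1) (hΔ : Δ = (1 - γ) / specRad (Gtilde n)) (ha0 : 0 < a₀)
    (hQ0 : Q ∈ 𝓝 (0 : State n))
    (hQ : ∀ x₀ ∈ Q, {x | Theta n a₀ x ≤ Theta n a₀ x₀} ⊆ Q)
    (hu : ∀ x ∈ Q, ‖control n k a₀ x‖ ≤ 1) :
    SolvesRobustSynthesis n k Q Δ (control n k a₀) (fun x₀ => Theta n a₀ x₀ / γ) where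
  nhds := hQ0
  bounded := hu
  steers R hR x₀ hx₀ := by
    have hf : closedLoop n k R (control n k a₀) = fun t x => loopField n a₀ (R t x) x := by
      ext t x : 2
      exact closedLoop_eq k R a₀ t x
    rw [hf]
    rcases eq_or_ne x₀ 0 with rfl | hne
    -- From the origin T = 0, so only the initial values have to be compared.
    · refine ⟨0, le_rfl, by simp [Theta_zero], fun _ => 0, ⟨rfl, fun _ _ => hx₀,
        continuousOn_const, fun t ht => absurd ht.2 (not_lt.2 ht.1)⟩,
        fun t ht => absurd ht.2 (not_lt.2 ht.1), rfl, fun T' y hy t ht ht0 => ?_⟩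
      rw [le_antisymm ht0 ht.1, hy.init]
    · obtain ⟨T, x, hT0, hT, hx, hxne, hxT⟩ :=
        exists_trajectory_to_origin hγ0 hγ hΔ ha0 hR hne (hQ x₀ hx₀)
      refine ⟨T, hT0, hT, x, hx, hxne, hxT, fun T' y hy t ht htT => ?_⟩
      exact (eqOn_of_trajectories ha0 hR (hx.restrict htT) (hy.restrict ht.2)
        (fun s hs => hxne s ⟨hs.1, hs.2.trans_le htT⟩) (right_mem_Icc.2 ht.1)).symm

end Korobov

theorem mainTheorem1 {r : ℕ} [NeZero r] (n : Fin r → ℕ) (hn : Antitone n) (hn1 : ∀ i, 1 ≤ n i)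
    (k : Matrix (Fin r) (Korobov.Idx n) ℝ) (γ Δ c a₀ : ℝ) (hγ0 : 0 < γ) (hγ1 : γ < 1)
    (hΔ : Δ = (1 - γ) / Korobov.specRad (Korobov.Gtilde n)) (hc : 0 < c) (ha0 : 0 < a₀)
    (ha : a₀ ≤ 2 / (Korobov.opNorm (Korobov.Finv n) *
      (Korobov.opNorm ((Korobov.B0 n)ᵀ * Korobov.F n) +
        2 * max (c ^ n 0) c * Korobov.opNorm ((Korobov.B0 n)ᵀ * Korobov.K n k)) ^ 2)) :
    -- the objects in the statement are well defined
    (Korobov.Finv n).PosDef ∧ (Korobov.F1 n).PosDef ∧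
    (∀ x : Korobov.State n, x ≠ 0 → ∃! θ : ℝ, Korobov.IsRoot n a₀ x θ) ∧
    -- the domain `Q` is an ellipsoid
    {x : Korobov.State n | Korobov.Theta n a₀ x ≤ c} =
      {x | Korobov.quadForm (Korobov.D n c * Korobov.F n * Korobov.D n c) x ≤ 2 * a₀ * c} ∧
    -- the local robust feedback synthesis
    Korobov.SolvesRobustSynthesis n k {x : Korobov.State n | Korobov.Theta n a₀ x ≤ c} Δ
      (Korobov.control n k a₀) (fun x₀ => Korobov.Theta n a₀ x₀ / γ) ∧
    -- the global robust feedback synthesis for vanishing `K`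
    (Korobov.K n k = 0 →
      Korobov.SolvesRobustSynthesis n k Set.univ Δ
        (Korobov.control n k a₀) (fun x₀ => Korobov.Theta n a₀ x₀ / γ)) := by
  rw [mul_assoc 2 (max _ _)] at ha
  refine ⟨Korobov.Finv_posDef, Korobov.F1_posDef, fun x hx => ?_, Korobov.setOf_Theta_le ha0 hc,
    ?_, fun hK => ?_⟩
  · obtain ⟨θ, hθ⟩ := Korobov.exists_isRoot ha0 hx
    exact ⟨θ, hθ, fun θ' hθ' => hθ'.eq hx hθ⟩
  · refine Korobov.solvesRobustSynthesis_of_bounded k hγ0 hγ1.le hΔ ha0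
      (Korobov.Theta_le_mem_nhds ha0 hc) (fun x₀ hx₀ x hx => (mem_ofPred.1 hx).trans hx₀) fun x hx => ?_
    refine Korobov.norm_control_le hn k ha0 ha
      (mul_le_mul_of_nonneg_right ?_ (Korobov.opNorm_nonneg _))
    have hx' : Korobov.Theta n a₀ x ≤ c := hx
    exact max_le_max (pow_le_pow_left₀ (Korobov.Theta_nonneg ha0 x) hx' _) hx'
  · refine Korobov.solvesRobustSynthesis_of_bounded k hγ0 hγ1.le hΔ ha0 univ_mem
      (fun _ _ => subset_univ _) fun x _ => Korobov.norm_control_le hn k ha0 ha (le_of_eq ?_)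
    -- With K = 0 the terms growing with Θ(x) and with c both vanish, so the control bound holds on
    -- the whole space.
    have h0 : Korobov.opNorm ((Korobov.B0 n)ᵀ * Korobov.K n k) = 0 := by
      rw [hK, Matrix.mul_zero, Korobov.opNorm, map_zero, map_zero, norm_zero]
    rw [h0, mul_zero, mul_zero]
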